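/- Let $d,m\ge 1$, let $(\mathcal F_k)_{k\ge 0}$ be a filtration on a probability space, $\theta\in\mathbb R^d$, and $$y_{k+1}=S_k(\phi_k^{\mathrm T}\theta+\epsilon_{k+1}),\qquad k\ge 0,$$ where, for thresholds $c_{1k}\le\dots\le c_{mk}$, $S_k(x)=1$ if $x\le c_{1k}$, $S_k(x)=i$ if $c_{(i-1)k}<x\le c_{ik}$ ($2\le i\le m$), and $S_k(x)=m+1$ if $x>c_{mk}$. Here $y_k$ is $\mathcal F_k$-measurable for $k\ge 1$. Assume: (1) The $c_{ik}$ are $\mathcal F_k$-measurable and there is a constant $\Lambda_c>0$ with $\sup_{k}\max\{c_{mk},-c_{1k}\}\le\Lambda_c$ a.s. (2) The $\phi_k\in\mathbb R^d$ are $\mathcal F_k$-measurable, $\sup_k\|\phi_k\|<\infty$ a.s., and $\theta$ is an interior point of a convex compact set $\mathcal K\subseteq\mathbb R^d$. Let $G_k$ be $\mathcal F_k$-measurable random variables with $\sup_{x\in\mathcal K}|\phi_k^{\mathrm T}x|\le G_k$ for all $k$, a.s. (3) $\epsilon_{k+1}$ has a conditional distribution function $F_{k+1}$ given $\mathcal F_k$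 (a regular version), with $F_{k+1}(0)=\tfrac12$ a.s. and with a continuous density $f_{k+1}$; and there is a constant $G$ with $\sup_kG_k\le G$ a.s. and $$0<\inf_{|x|\le G+\Lambda_c,\,k\ge0}f_{k+1}(x)\le\sup_{|x|\le G+\Lambda_c,\,k\ge0}f_{k+1}(x)<\infty\quad\text{a.s.}$$ For positive definite $A$ put $\|z\|_A^2=z^{\mathrm T}Az$ and $\Pi_A(x)=\arg\min_{z\in\mathcal K}\|x-z\|_A$. Let $\bar\mu_k,\mu_k$ be $\mathcal F_k$-measurable with $0<\inf_k\bar\mu_k\le\sup_k\bar\mu_k<\infty$ and $0<\inf_k\mu_k\le\sup_k\mu_k<\infty$, let $\bar\theta_0,\theta_0\in\mathcal K$, and let $\bar P_0,P_0$ be positive definite (all four deterministic). For $x\in\mathbb R$ let $$v_{k+1}(x)=\operatorname{sgn}[y_{k+1}-S_k(x)]+\begin{cases}F_{k+1}(c_{1k}-x)-1,&x\le c_{1k},\\F_{k+1}(c_{(i-1)k}-x)-[1-F_{k+1}(c_{ik}-x)],&c_{(i-1)k}<x\le c_{ik},\\F_{k+1}(c_{mk}-x),&x>c_{mk}.\end{cases}$$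 The preliminary estimates $\bar\theta_k$ are defined by $$\bar\theta_{k+1}=\Pi_{\bar P_{k+1}^{-1}}\{\bar\theta_k+\bar a_k\bar P_k\phi_k\,v_{k+1}(\phi_k^{\mathrm T}\bar\theta_k)\},\quad \bar P_{k+1}=\bar P_k-\bar a_k\bar\beta_k\bar P_k\phi_k\phi_k^{\mathrm T}\bar P_k,$$ $$\bar a_k=\frac1{\bar\mu_k+\bar\beta_k\phi_k^{\mathrm T}\bar P_k\phi_k},\quad \bar\beta_k=\inf_{|x|\le\max\{G_k+c_{mk},\,G_k-c_{1k}\}}f_{k+1}(x).$$ The accelerated estimates $\theta_k$ are defined by $$\theta_{k+1}=\Pi_{P_{k+1}^{-1}}\{\theta_k+a_kP_k\phi_k\,v_{k+1}(\phi_k^{\mathrm T}\theta_k)\},\quad P_{k+1}=P_k-a_k\beta_kP_k\phi_k\phi_k^{\mathrm T}P_k,\quad a_k=\frac1{\mu_k+\beta_k\phi_k^{\mathrm T}P_k\phi_k},$$ where, with $\Delta_k=\phi_k^{\mathrm T}(\bar\theta_k-\theta_k)$ and with $q_i=\Delta_k^{-1}[F_{k+1}(c_{ik}-\phi_k^{\mathrm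 T}\theta_k)-F_{k+1}(c_{ik}-\phi_k^{\mathrm T}\bar\theta_k)]$ if $\Delta_k\ne0$ and $q_i=f_{k+1}(c_{ik}-\phi_k^{\mathrm T}\theta_k)$ if $\Delta_k=0$, $$\beta_k=\begin{cases}q_1,&\phi_k^{\mathrm T}\theta_k\le c_{1k},\\q_{i-1}+q_i,&c_{(i-1)k}<\phi_k^{\mathrm T}\theta_k\le c_{ik},\\q_m,&\phi_k^{\mathrm T}\theta_k>c_{mk}.\end{cases}$$ Let $\lambda_{\min}(k)$ and $\lambda_{\max}(k)$ be the smallest and largest eigenvalues of $P_0^{-1}+\sum_{i=0}^k\phi_i\phi_i^{\mathrm T}$. Then almost surely, on the event that $\lambda_{\max}(k)>1$ for some $k$ (equivalently, that $\log\lambda_{\max}(k)>0$ for all large $k$), $$\|\theta-\theta_{k+1}\|^2=O\!\left(\frac{\log\lambda_{\max}(k)}{\lambda_{\min}(k)}\right)\qquad(k\to\infty),$$ where the implied constant may depend on the sample point. Consequently, for almost every sample point of that event at which $\log\lambda_{\max}(k)/\lambda_{\min}(k)\to0$, one has $\theta_k\to\theta$. -/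

import Mathlib

open MeasureTheory ProbabilityTheory Filter Topology Asymptotics Matrix

noncomputable section

namespace ADA

/-- Vectors of `ℝ^d` as coordinate functions. Their Euclidean norm is always written explicitly as
`‖WithLp.toLp 2 v‖`; the topology is the usual one. -/
abbrev Vec (d : ℕ) : Type := Fin d → ℝ

/-- Real `d × d` matrices. -/
abbrev Mat (d : ℕ) : Type := Matrix (Fin d) (Fin d) ℝ

/-- The saturation function with thresholds `c 1 ≤ ⋯ ≤ c m`: it is `1` for `x ≤ c 1`, it is `i` for
`c (i - 1) < x ≤ c i`, and it is `m + 1` for `c m < x`. For ordered thresholds this is one plus the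
number of thresholds lying strictly below `x`. Only the values `c 1, …, c m` are used. -/
def quantizer (m : ℕ) (c : ℕ → ℝ) (x : ℝ) : ℕ :=
  1 + ((Finset.Icc 1 m).filter (fun i => c i < x)).card

/-- `‖z‖_A ^ 2 = zᵀ A z`. -/
def wnormSq {d : ℕ} (A : Mat d) (z : Vec d) : ℝ := z ⬝ᵥ (A *ᵥ z)

/-- The projection `argmin_{y ∈ K} ‖x - y‖_A`. The minimizer exists and is unique when `K` is a nonempty
compact convex set and `A` is positive definite. -/
def proj {d : ℕ} (K : Set (Vec d)) (A : Mat d) (x : Vec d) : Vec d :=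
  Classical.epsilon (fun y => y ∈ K ∧ ∀ z ∈ K, wnormSq A (x - y) ≤ wnormSq A (x - z))

/-- The data entering the update from time `k` to time `k + 1`: the regressor `φ_k`, the thresholds
`c_{1k}, …, c_{mk}`, the conditional distribution function and density `F_{k+1}`, `f_{k+1}` of the noise,
the bound `G_k`, the step parameters `μbar_k`, `μ_k`, and the observation `y_{k+1}`. -/
structure Sample (d : ℕ) where
  φ : Vec d
  c : ℕ → ℝ
  F : ℝ → ℝ
  f : ℝ → ℝ
  G : ℝ
  μbar : ℝ
  μ : ℝ
  y : ℕ

/-- The term added to the sign in `v_{k+1}`, where `x = φ_kᵀ θ_k` is the current prediction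
and `δ_i = c_i - x`. -/
def correction (m : ℕ) (c : ℕ → ℝ) (F : ℝ → ℝ) (x : ℝ) : ℝ :=
  if x ≤ c 1 then F (c 1 - x) - 1
  else if c m < x then F (c m - x)
  else F (c (quantizer m c x - 1) - x) - (1 - F (c (quantizer m c x) - x))

/-- The innovation `v_{k+1}` at the prediction `x`. -/
def innovation {d : ℕ} (m : ℕ) (s : Sample d) (x : ℝ) : ℝ :=
  Real.sign ((s.y : ℝ) - (quantizer m s.c x : ℝ)) + correction m s.c s.F x

/-- The adaptation gain of the first step: the infimum of the density over
`|x| ≤ max (G_k + c_{mk}) (G_k - c_{1k})`. -/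
def betaBar {d : ℕ} (m : ℕ) (s : Sample d) : ℝ :=
  sInf (s.f '' {x : ℝ | |x| ≤ max (s.G + s.c m) (s.G - s.c 1)})

/-- `(F(t - x) - F(t - xbar)) / Δ` if `Δ = xbar - x ≠ 0`, and `f(t - x)` if `Δ = 0`. -/
def slope (F f : ℝ → ℝ) (t x xbar : ℝ) : ℝ :=
  if xbar - x ≠ 0 then (F (t - x) - F (t - xbar)) / (xbar - x) else f (t - x)

/-- The adaptation gain `β_k` of the second step, where `x = φ_kᵀ θ_k` and `xbar = φ_kᵀ θbar_k`. -/
def beta {d : ℕ} (m : ℕ) (s : Sample d) (x xbar : ℝ) : ℝ :=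
  if x ≤ s.c 1 then slope s.F s.f (s.c 1) x xbar
  else if s.c m < x then slope s.F s.f (s.c m) x xbar
  else slope s.F s.f (s.c (quantizer m s.c x - 1)) x xbar
    + slope s.F s.f (s.c (quantizer m s.c x)) x xbar

/-- `a = 1 / (μ + β φᵀ P φ)`. -/
def gain {d : ℕ} (P : Mat d) (φ : Vec d) (μ β : ℝ) : ℝ := 1 / (μ + β * (φ ⬝ᵥ (P *ᵥ φ)))

/-- `P - a β P φ φᵀ P`. -/
def updateP {d : ℕ} (P : Mat d) (φ : Vec d) (μ β : ℝ) : Mat d :=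
  P - (gain P φ μ β * β) • (P * vecMulVec φ φ * P)

/-- The projection, in the norm of the inverse of the updated matrix, of `θ + a P φ v`. -/
def updateTheta {d : ℕ} (K : Set (Vec d)) (θ : Vec d) (P : Mat d) (φ : Vec d) (μ β v : ℝ) : Vec d :=
  proj K (updateP P φ μ β)⁻¹ (θ + (gain P φ μ β * v) • (P *ᵥ φ))

/-- The state `(θbar_k, Pbar_k, θ_k, P_k)` of the two-step algorithm. -/
structure State (d : ℕ) where
  θbar : Vec d
  Pbar : Mat d
  θ : Vec d
  P : Mat d

/-- One update of both steps of the algorithm. -/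
def step {d : ℕ} (m : ℕ) (K : Set (Vec d)) (s : Sample d) (σ : State d) : State d where
  θbar := updateTheta K σ.θbar σ.Pbar s.φ s.μbar (betaBar m s) (innovation m s (s.φ ⬝ᵥ σ.θbar))
  Pbar := updateP σ.Pbar s.φ s.μbar (betaBar m s)
  θ := updateTheta K σ.θ σ.P s.φ s.μ (beta m s (s.φ ⬝ᵥ σ.θ) (s.φ ⬝ᵥ σ.θbar))
    (innovation m s (s.φ ⬝ᵥ σ.θ))
  P := updateP σ.P s.φ s.μ (beta m s (s.φ ⬝ᵥ σ.θ) (s.φ ⬝ᵥ σ.θbar))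

/-- The states of the algorithm along a sequence of samples, from the initial state `σ₀`. -/
def run {d : ℕ} (m : ℕ) (K : Set (Vec d)) (σ₀ : State d) (s : ℕ → Sample d) : ℕ → State d
  | 0 => σ₀
  | k + 1 => step m K (s k) (run m K σ₀ s k)

/-- `P₀⁻¹ + ∑_{i=0}^{k} φ_i φ_iᵀ`. -/
def infoMatrix {d : ℕ} (P₀ : Mat d) (φ : ℕ → Vec d) (k : ℕ) : Mat d :=
  P₀⁻¹ + ∑ i ∈ Finset.range (k + 1), vecMulVec (φ i) (φ i)

/-- The smallest eigenvalue of a symmetric matrix (of size at least one). -/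
def lamMin {d : ℕ} (M : Mat d) : ℝ := sInf (spectrum ℝ M)

/-- The largest eigenvalue of a symmetric matrix (of size at least one). -/
def lamMax {d : ℕ} (M : Mat d) : ℝ := sSup (spectrum ℝ M)

/-- `F` is a (regular version of the) conditional distribution function of the random variable `X` given
the σ-algebra `𝒢`, and it has the continuous density `f`. -/
structure IsCondLaw {Ω : Type*} [mΩ : MeasurableSpace Ω] (Pr : Measure Ω) (𝒢 : MeasurableSpace Ω)
    (X : Ω → ℝ) (F f : Ω → ℝ → ℝ) : Prop where
  measurable_cdf : ∀ x : ℝ, Measurable[𝒢] (fun ω => F ω x)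
  condProb : ∀ x : ℝ,
    Pr[Set.indicator {ω | X ω ≤ x} (fun _ => (1 : ℝ)) | 𝒢] =ᵐ[Pr] fun ω => F ω x
  density_continuous : ∀ ω, Continuous (f ω)
  density_nonneg : ∀ ω x, 0 ≤ f ω x
  density_integrable : ∀ ω, Integrable (f ω)
  density_integral : ∀ ω, ∫ t, f ω t = 1
  cdf_eq : ∀ ω x, F ω x = ∫ t in Set.Iic x, f ω t

end ADA

end

/-! ### Linear algebra: weighted norms, rank-one updates, projections, extreme eigenvalues. -/

noncomputable section

namespace ADA

variable {d : ℕ}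

/-! Each of the two recursions is analysed with the Lyapunov function `V_k = ‖θ - θ_k‖²` in the norm
of `P_k⁻¹`. By Sherman-Morrison, `P_{k+1}⁻¹ = P_k⁻¹ + (β_k/μ_k) φ_k φ_kᵀ`, and projecting in the
`P_{k+1}⁻¹` norm cannot increase the distance to `θ ∈ K`. With `x_k = φ_kᵀ(θ - θ_k)` this gives
`V_{k+1} ≤ V_k + (β_k/μ_k) x_k² - (2/μ_k) x_k v_{k+1} + (v_{k+1}/μ_k)² φ_kᵀ P_{k+1} φ_k`
(`wnormSq_updateTheta_le`). The innovations are bounded and the last quadratic form is dominated by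
an increment of `log det P_k⁻¹` (`quadratic_le_log_det`), so these terms sum to `O(log λ_max)`, up
to an additive constant.

The innovation is a sum over the one or two thresholds bounding the cell of the prediction
(`innovation_eq`). It splits into a predictable drift and a bounded martingale difference. An
exponential supermartingale shows that the weighted noise sums are at most `δ ∑ x_i²` plus a random
constant, for every `δ > 0` (`ae_forall_exists_sum_mul_le`), so the negative drift absorbs them.

For the preliminary step, monotonicity of `F` makes `x_k` times the drift at least `βbar_k x_k²`;
hence the squared preliminary prediction errors sum to `O(1 + log λ_max)`. For the accelerated step,
`β_k` consists of secant slopes of `F` between the two predictions. The drift then equals `β_k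
φ_kᵀ(θbar_k - θ_k)` up to a multiple of the preliminary prediction error (`abs_drift_sub_le`), whose
squares have just been summed.

Thus `V_n = O(1 + log λ_max)`. Since `P_{n+1}⁻¹` dominates a positive multiple of the information
matrix, `λ_min ‖θ - θ_{n+1}‖²` has the same bound, and the constant is absorbed once `log λ_max` is
positive. -/

lemma dotProduct_mulVec_comm {A : Mat d} (hA : A.IsHermitian) (u v : Vec d) :
    u ⬝ᵥ (A *ᵥ v) = v ⬝ᵥ (A *ᵥ u) := by
  have h : Aᵀ = A := by simpa [Matrix.IsHermitian] using hA
  rw [dotProduct_mulVec, ← mulVec_transpose, h, dotProduct_comm]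

lemma wnormSq_sub {A : Mat d} (hA : A.IsHermitian) (u v : Vec d) :
    wnormSq A (u - v) = wnormSq A u - 2 * (u ⬝ᵥ (A *ᵥ v)) + wnormSq A v := by
  unfold wnormSq
  rw [mulVec_sub, sub_dotProduct, dotProduct_sub, dotProduct_sub, dotProduct_mulVec_comm hA v u]
  ring

lemma wnormSq_smul (A : Mat d) (t : ℝ) (u : Vec d) :
    wnormSq A (t • u) = t ^ 2 * wnormSq A u := by
  unfold wnormSq
  rw [mulVec_smul, smul_dotProduct, dotProduct_smul, smul_eq_mul, smul_eq_mul]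
  ring

lemma wnormSq_pos {A : Mat d} (hA : A.PosDef) {u : Vec d} (hu : u ≠ 0) : 0 < wnormSq A u := by
  simpa [wnormSq] using hA.dotProduct_mulVec_pos hu

lemma wnormSq_nonneg {A : Mat d} (hA : A.PosSemidef) (u : Vec d) : 0 ≤ wnormSq A u := by
  simpa [wnormSq] using hA.dotProduct_mulVec_nonneg u

lemma wnormSq_add_smul_vecMulVec (A : Mat d) (t : ℝ) (φ u : Vec d) :
    wnormSq (A + t • vecMulVec φ φ) u = wnormSq A u + t * (φ ⬝ᵥ u) ^ 2 := by
  unfold wnormSq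
  rw [add_mulVec, dotProduct_add, smul_mulVec, dotProduct_smul, vecMulVec_mulVec, op_smul_eq_smul,
    dotProduct_smul, dotProduct_comm u φ, smul_eq_mul, smul_eq_mul]
  ring

lemma posSemidef_vecMulVec_self (φ : Vec d) : (vecMulVec φ φ : Mat d).PosSemidef := by
  simpa using posSemidef_vecMulVec_self_star φ

lemma posDef_add_smul_vecMulVec {A : Mat d} (hA : A.PosDef) {t : ℝ} (ht : 0 ≤ t) (φ : Vec d) :
    (A + t • vecMulVec φ φ).PosDef :=
  hA.add_posSemidef ((posSemidef_vecMulVec_self φ).smul ht)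

lemma gain_denom_pos {P : Mat d} (hP : P.PosDef) (φ : Vec d) {μ β : ℝ} (hμ : 0 < μ)
    (hβ : 0 ≤ β) : 0 < μ + β * (φ ⬝ᵥ (P *ᵥ φ)) := by
  have : 0 ≤ φ ⬝ᵥ (P *ᵥ φ) := wnormSq_nonneg hP.posSemidef φ
  positivity

/-- Sherman-Morrison. Since `φφᵀPφφᵀ` is a scalar multiple of `φφᵀ`, everything reduces to a scalar
identity for the coefficient of `Pφφᵀ`. -/
lemma updateP_mul {P : Mat d} (hP : P.PosDef) (φ : Vec d) {μ β : ℝ} (hμ : 0 < μ)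
    (hβ : 0 ≤ β) : updateP P φ μ β * (P⁻¹ + (β / μ) • vecMulVec φ φ) = 1 := by
  have hD := gain_denom_pos hP φ hμ hβ
  have hu : IsUnit P.det := hP.isUnit.map detMonoidHom
  set p := φ ⬝ᵥ (P *ᵥ φ) with hp
  have h1 : P * P⁻¹ = 1 := mul_nonsing_inv _ hu
  have h2 : vecMulVec φ φ * P * vecMulVec φ φ = p • vecMulVec φ φ := by
    rw [Matrix.mul_assoc, mul_vecMulVec, vecMulVec_mul_vecMulVec]
    simp [hp, vecMulVec_smul]
  unfold updateP gain
  rw [← hp, sub_mul, mul_add, mul_add, h1, smul_mul_assoc, smul_mul_assoc, Matrix.mul_assoc _ P P⁻¹,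
    h1, mul_one, mul_smul_comm, mul_smul_comm, Matrix.mul_assoc P, Matrix.mul_assoc P, h2,
    mul_smul_comm]
  have h3 : β / μ - (1 / (μ + β * p) * β + 1 / (μ + β * p) * β * (β / μ * p)) = 0 := by
    field_simp
    ring
  calc _ = 1 + (β / μ - (1 / (μ + β * p) * β + 1 / (μ + β * p) * β * (β / μ * p))) •
        (P * vecMulVec φ φ) := by module
    _ = 1 := by rw [h3]; simp

lemma updateP_inv {P : Mat d} (hP : P.PosDef) (φ : Vec d) {μ β : ℝ} (hμ : 0 < μ)
    (hβ : 0 ≤ β) : (updateP P φ μ β)⁻¹ = P⁻¹ + (β / μ) • vecMulVec φ φ :=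
  inv_eq_right_inv (updateP_mul hP φ hμ hβ)

lemma posDef_updateP_inv {P : Mat d} (hP : P.PosDef) (φ : Vec d) {μ β : ℝ} (hμ : 0 < μ)
    (hβ : 0 ≤ β) : (updateP P φ μ β)⁻¹.PosDef := by
  rw [updateP_inv hP φ hμ hβ]
  exact posDef_add_smul_vecMulVec hP.inv (by positivity) φ

lemma posDef_updateP {P : Mat d} (hP : P.PosDef) (φ : Vec d) {μ β : ℝ} (hμ : 0 < μ)
    (hβ : 0 ≤ β) : (updateP P φ μ β).PosDef := by
  have h := updateP_mul hP φ hμ hβ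
  rw [← inv_eq_left_inv h]
  exact (posDef_add_smul_vecMulVec hP.inv (by positivity) φ).inv

lemma updateP_mulVec {P : Mat d} (hP : P.PosDef) (φ : Vec d) {μ β : ℝ} (hμ : 0 < μ)
    (hβ : 0 ≤ β) : updateP P φ μ β *ᵥ φ = (gain P φ μ β * μ) • (P *ᵥ φ) := by
  have hD := gain_denom_pos hP φ hμ hβ
  unfold updateP
  rw [sub_mulVec, smul_mulVec, ← mulVec_mulVec, ← mulVec_mulVec, vecMulVec_mulVec]
  have : gain P φ μ β * μ = 1 - gain P φ μ β * β * (φ ⬝ᵥ (P *ᵥ φ)) := by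
    unfold gain
    field_simp
    ring
  rw [this, sub_smul, one_smul]
  simp [mulVec_smul, smul_smul]

/-- Expressing the correction through the updated matrix makes it cancel against the inverse that
defines the new norm. -/
lemma gain_smul_mulVec {P : Mat d} (hP : P.PosDef) (φ : Vec d) {μ β : ℝ} (hμ : 0 < μ)
    (hβ : 0 ≤ β) (v : ℝ) :
    (gain P φ μ β * v) • (P *ᵥ φ) = (v / μ) • (updateP P φ μ β *ᵥ φ) := by
  rw [updateP_mulVec hP φ hμ hβ, smul_smul]
  congr 1
  field_simp

/-- By the matrix determinant lemma the determinant grows by the factor `t = 1 + (β/μ) φᵀPφ`. The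
left side is exactly `1 - 1/t`, which is at most `log t`. -/
lemma quadratic_le_log_det {P : Mat d} (hP : P.PosDef) (φ : Vec d) {μ β : ℝ} (hμ : 0 < μ)
    (hβ : 0 ≤ β) : β / μ * (φ ⬝ᵥ (updateP P φ μ β *ᵥ φ)) ≤
      Real.log (updateP P φ μ β)⁻¹.det - Real.log P⁻¹.det := by
  have hD := gain_denom_pos hP φ hμ hβ
  have hp0 : 0 ≤ φ ⬝ᵥ (P *ᵥ φ) := wnormSq_nonneg hP.posSemidef φ
  rw [updateP_mulVec hP φ hμ hβ, updateP_inv hP φ hμ hβ]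
  have hdet : (P⁻¹ + (β / μ) • vecMulVec φ φ).det
      = P⁻¹.det * (1 + β / μ * (φ ⬝ᵥ (P *ᵥ φ))) := by
    have h1 := hP.isUnit
    have h2 : IsUnit P⁻¹.det := hP.inv.isUnit.map detMonoidHom
    rw [← smul_vecMulVec, vecMulVec_eq (Fin 1), det_add_replicateCol_mul_replicateRow h2]
    rw [nonsing_inv_nonsing_inv _ (h1.map detMonoidHom)]
    have h3 : (replicateRow (Fin 1) φ * P * replicateCol (Fin 1) φ) 0 0 = φ ⬝ᵥ (P *ᵥ φ) := by
      rw [Matrix.mul_assoc, ← replicateCol_mulVec]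
      simp [Matrix.mul_apply, dotProduct]
    simp [h3]
  have hq : 0 < 1 + β / μ * (φ ⬝ᵥ (P *ᵥ φ)) := by positivity
  rw [hdet, Real.log_mul hP.inv.det_pos.ne' hq.ne', add_sub_cancel_left, dotProduct_smul,
    smul_eq_mul]
  refine le_trans (le_of_eq ?_) (Real.one_sub_inv_le_log_of_pos hq)
  unfold gain
  field_simp
  ring

lemma exists_proj {K : Set (Vec d)} (hK : IsCompact K) (hne : K.Nonempty) (A : Mat d) (x : Vec d) :
    ∃ y, y ∈ K ∧ ∀ z ∈ K, wnormSq A (x - y) ≤ wnormSq A (x - z) := by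
  have hc : Continuous fun y => wnormSq A (x - y) := by unfold wnormSq; fun_prop
  obtain ⟨y, hy, h⟩ := hK.exists_isMinOn hne hc.continuousOn
  exact ⟨y, hy, fun z hz => h hz⟩

lemma proj_spec {K : Set (Vec d)} (hK : IsCompact K) (hne : K.Nonempty) (A : Mat d) (x : Vec d) :
    proj K A x ∈ K ∧ ∀ z ∈ K, wnormSq A (x - proj K A x) ≤ wnormSq A (x - z) :=
  Classical.epsilon_spec (exists_proj hK hne A x)

/-- The variational inequality for the projection: moving from `y` slightly towards `z` stays in
`K`, so the first-order change of the squared distance cannot be negative. -/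
lemma inner_nonpos_of_isMinimizer {K : Set (Vec d)} (hK : Convex ℝ K) {A : Mat d}
    (hA : A.PosDef) {x y z : Vec d} (hy : y ∈ K)
    (hmin : ∀ z ∈ K, wnormSq A (x - y) ≤ wnormSq A (x - z)) (hz : z ∈ K) :
    (x - y) ⬝ᵥ (A *ᵥ (z - y)) ≤ 0 := by
  by_contra! h
  set q := wnormSq A (z - y)
  set p := (x - y) ⬝ᵥ (A *ᵥ (z - y)) with hp
  have hq : 0 ≤ q := wnormSq_nonneg hA.posSemidef _
  have key : ∀ t : ℝ, 0 < t → t ≤ 1 → 2 * p ≤ t * q := by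
    intro t h0 h1
    have hm := hmin (y + t • (z - y)) (hK.add_smul_sub_mem hy hz ⟨h0.le, h1⟩)
    rw [← sub_sub, wnormSq_sub hA.1 (x - y), wnormSq_smul, mulVec_smul, dotProduct_smul, ← hp,
      smul_eq_mul] at hm
    have : t * (2 * p) ≤ t * (t * q) := by
      change _ ≤ _ - 2 * (t * p) + t ^ 2 * q at hm
      nlinarith
    exact le_of_mul_le_mul_left this h0
  -- This step length is small enough that the second-order term `t * q` is at most `p`,
  -- contradicting `2 * p ≤ t * q` with `p > 0`.
  have h1 := key (min 1 (p / (q + 1))) (by positivity) (min_le_left _ _)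
  have h2 : min 1 (p / (q + 1)) * q ≤ p / (q + 1) * q := by gcongr; exact min_le_right _ _
  have h3 : p / (q + 1) * q ≤ p := by
    rw [div_mul_eq_mul_div, div_le_iff₀ (by positivity)]; nlinarith
  linarith

lemma isMinimizer_unique {K : Set (Vec d)} (hK : Convex ℝ K) {A : Mat d}
    (hA : A.PosDef) {x y z : Vec d} (hy : y ∈ K)
    (hymin : ∀ z ∈ K, wnormSq A (x - y) ≤ wnormSq A (x - z)) (hz : z ∈ K)
    (hzmin : ∀ y ∈ K, wnormSq A (x - z) ≤ wnormSq A (x - y)) : z = y := by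
  by_contra hne
  have h1 := inner_nonpos_of_isMinimizer hK hA hy hymin hz
  have h2 := wnormSq_pos hA (sub_ne_zero.mpr hne)
  have h3 := wnormSq_sub hA.1 (x - y) (z - y)
  rw [sub_sub_sub_cancel_right] at h3
  linarith [hzmin y hy]

/-- The angle at the projection between `x` and any point of `K` is obtuse, so expanding `θ - x`
around the projection leaves only nonnegative extra terms. -/
lemma wnormSq_sub_proj_le {K : Set (Vec d)} (hK : Convex ℝ K) (hc : IsCompact K) {A : Mat d}
    (hA : A.PosDef) {θ : Vec d} (hθ : θ ∈ K) (x : Vec d) :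
    wnormSq A (θ - proj K A x) ≤ wnormSq A (θ - x) := by
  obtain ⟨hy, hmin⟩ := proj_spec hc ⟨θ, hθ⟩ A x
  have h1 := inner_nonpos_of_isMinimizer hK hA hy hmin hθ
  have h2 := wnormSq_sub hA.1 (θ - proj K A x) (x - proj K A x)
  rw [sub_sub_sub_cancel_right, dotProduct_mulVec_comm hA.1] at h2
  linarith [wnormSq_nonneg hA.posSemidef (x - proj K A x)]

/-- The one-step inequality of the projected recursive algorithm. -/
lemma wnormSq_updateTheta_le {K : Set (Vec d)} (hK : Convex ℝ K) (hc : IsCompact K)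
    {P : Mat d} (hP : P.PosDef) (φ : Vec d) {μ β : ℝ} (hμ : 0 < μ) (hβ : 0 ≤ β)
    {θ : Vec d} (hθ : θ ∈ K) (η : Vec d) (v : ℝ) :
    wnormSq (updateP P φ μ β)⁻¹ (θ - updateTheta K η P φ μ β v) ≤
      wnormSq P⁻¹ (θ - η) + β / μ * (φ ⬝ᵥ (θ - η)) ^ 2 - 2 / μ * (φ ⬝ᵥ (θ - η)) * v
        + (v / μ) ^ 2 * (φ ⬝ᵥ (updateP P φ μ β *ᵥ φ)) := by
  have hQ := posDef_updateP_inv hP φ hμ hβ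
  refine (wnormSq_sub_proj_le hK hc hQ hθ _).trans (le_of_eq ?_)
  rw [gain_smul_mulVec hP φ hμ hβ, ← sub_sub, wnormSq_sub hQ.1]
  -- With this cancellation the cross term becomes `φᵀ(θ - η)` and the square of the correction
  -- becomes `φᵀ P_{k+1} φ`.
  have hinv : (updateP P φ μ β)⁻¹ *ᵥ (updateP P φ μ β *ᵥ φ) = φ := by
    rw [mulVec_mulVec, nonsing_inv_mul _ ((posDef_updateP hP φ hμ hβ).isUnit.map detMonoidHom),
      one_mulVec]
  rw [mulVec_smul, hinv, wnormSq_smul]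
  have h2 : wnormSq (updateP P φ μ β)⁻¹ (updateP P φ μ β *ᵥ φ)
      = φ ⬝ᵥ (updateP P φ μ β *ᵥ φ) := by
    unfold wnormSq
    rw [hinv, dotProduct_comm]
  rw [h2, updateP_inv hP φ hμ hβ, wnormSq_add_smul_vecMulVec, dotProduct_smul, dotProduct_comm _ φ]
  simp only [smul_eq_mul]
  ring

lemma updateTheta_mem {K : Set (Vec d)} (hc : IsCompact K) (hne : K.Nonempty)
    (η : Vec d) (P : Mat d) (φ : Vec d) (μ β v : ℝ) : updateTheta K η P φ μ β v ∈ K :=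
  (proj_spec hc hne _ _).1

/-- Subtracting the scalar matrix `lamMin M` shifts the spectrum into the nonnegative half-line, so
the difference is positive semidefinite. -/
lemma lamMin_mul_le {M : Mat d} (hM : M.IsHermitian) (u : Vec d) :
    lamMin M * (u ⬝ᵥ u) ≤ wnormSq M u := by
  have hfin : (spectrum ℝ M).Finite := by
    rw [hM.spectrum_real_eq_range_eigenvalues]; exact Set.finite_range _
  have h : (M - algebraMap ℝ (Mat d) (lamMin M)).PosSemidef := by
    rw [posSemidef_iff_isHermitian_and_spectrum_nonneg]
    refine ⟨hM.sub ?_, ?_⟩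
    · rw [algebraMap_eq_diagonal]; exact isHermitian_diagonal _
    · rw [← spectrum.sub_singleton_eq]
      rintro _ ⟨a, ha, b, rfl, rfl⟩
      exact sub_nonneg.mpr (csInf_le hfin.bddBelow ha)
  have := wnormSq_nonneg h u
  unfold wnormSq at this ⊢
  rw [sub_mulVec, dotProduct_sub, Algebra.algebraMap_eq_smul_one, smul_mulVec, one_mulVec,
    dotProduct_smul, smul_eq_mul] at this
  linarith

lemma wnormSq_le_lamMax_mul {M : Mat d} (hM : M.IsHermitian) (u : Vec d) :
    wnormSq M u ≤ lamMax M * (u ⬝ᵥ u) := by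
  have hfin : (spectrum ℝ M).Finite := by
    rw [hM.spectrum_real_eq_range_eigenvalues]; exact Set.finite_range _
  have h : (algebraMap ℝ (Mat d) (lamMax M) - M).PosSemidef := by
    rw [posSemidef_iff_isHermitian_and_spectrum_nonneg]
    refine ⟨IsHermitian.sub ?_ hM, ?_⟩
    · rw [algebraMap_eq_diagonal]; exact isHermitian_diagonal _
    · rw [← spectrum.singleton_sub_eq]
      rintro _ ⟨a, rfl, b, hb, rfl⟩
      exact sub_nonneg.mpr (le_csSup hfin.bddAbove hb)
  have := wnormSq_nonneg h u
  unfold wnormSq at this ⊢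
  rw [sub_mulVec, dotProduct_sub, Algebra.algebraMap_eq_smul_one, smul_mulVec, one_mulVec,
    dotProduct_smul, smul_eq_mul] at this
  linarith

lemma spectrum_nonempty_finite (hd : 1 ≤ d) {M : Mat d} (hM : M.IsHermitian) :
    (spectrum ℝ M).Nonempty ∧ (spectrum ℝ M).Finite := by
  have : Nonempty (Fin d) := ⟨⟨0, hd⟩⟩
  rw [hM.spectrum_real_eq_range_eigenvalues]
  exact ⟨Set.range_nonempty _, Set.finite_range _⟩

lemma lamMin_pos (hd : 1 ≤ d) {M : Mat d} (hM : M.PosDef) : 0 < lamMin M := by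
  obtain ⟨hne, hfin⟩ := spectrum_nonempty_finite hd hM.1
  have h := hne.csInf_mem hfin
  rw [← lamMin, hM.1.spectrum_real_eq_range_eigenvalues] at h
  obtain ⟨i, hi⟩ := h
  rw [← hi]
  exact hM.eigenvalues_pos i

lemma trace_le_lamMax {M : Mat d} (hM : M.IsHermitian) : M.trace ≤ d * lamMax M := by
  have hfin : (spectrum ℝ M).Finite := by
    rw [hM.spectrum_real_eq_range_eigenvalues]; exact Set.finite_range _
  rw [hM.trace_eq_sum_eigenvalues]
  calc _ ≤ ∑ _i : Fin d, lamMax M := Finset.sum_le_sum fun i _ =>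
        le_csSup hfin.bddAbove (hM.eigenvalues_mem_spectrum_real i)
    _ = d * lamMax M := by simp

lemma lamMax_pos (hd : 1 ≤ d) {M : Mat d} (hM : M.PosDef) : 0 < lamMax M := by
  obtain ⟨hne, hfin⟩ := spectrum_nonempty_finite hd hM.1
  exact (lamMin_pos hd hM).trans_le (csInf_le_csSup hne hfin.bddBelow hfin.bddAbove)

/-- Test the inequality of quadratic forms on an eigenvector of `M` for its largest eigenvalue. -/
lemma lamMax_le_lamMax (hd : 1 ≤ d) {M N : Mat d} (hM : M.IsHermitian) (hN : N.IsHermitian)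
    (h : ∀ u, wnormSq M u ≤ wnormSq N u) : lamMax M ≤ lamMax N := by
  obtain ⟨hne, hfin⟩ := spectrum_nonempty_finite hd hM
  have hmem : lamMax M ∈ spectrum ℝ M := hne.csSup_mem hfin
  rw [hM.spectrum_real_eq_range_eigenvalues] at hmem
  obtain ⟨i, hi⟩ := hmem
  set u : Vec d := WithLp.ofLp (hM.eigenvectorBasis i) with hu
  have hu0 : u ≠ 0 := by
    intro h0
    apply hM.eigenvectorBasis.toBasis.ne_zero i
    ext j
    simpa using congrFun h0 j
  have huu : 0 < u ⬝ᵥ u := by simpa using dotProduct_star_self_pos_iff.mpr hu0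
  have h1 : wnormSq M u = lamMax M * (u ⬝ᵥ u) := by
    unfold wnormSq
    rw [hu, hM.mulVec_eigenvectorBasis i, dotProduct_smul, hi, smul_eq_mul]
  have h2 := (h u).trans (wnormSq_le_lamMax_mul hN u)
  rw [h1] at h2
  exact le_of_mul_le_mul_right h2 huu

/-- Every eigenvalue is positive, hence at most the trace, and the determinant is the product of `d`
of them. -/
lemma log_det_le (hd : 1 ≤ d) {M : Mat d} (hM : M.PosDef) :
    Real.log M.det ≤ d * Real.log M.trace := by
  have : Nonempty (Fin d) := ⟨⟨0, hd⟩⟩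
  have ht := hM.trace_pos
  rw [← Real.log_pow]
  apply Real.log_le_log hM.det_pos
  rw [hM.1.det_eq_prod_eigenvalues]
  calc _ ≤ ∏ _i : Fin d, M.trace := by
        refine Finset.prod_le_prod (fun i _ => (hM.eigenvalues_pos i).le) fun i _ => ?_
        rw [hM.1.trace_eq_sum_eigenvalues]
        exact Finset.single_le_sum (f := fun i => (hM.1.eigenvalues i : ℝ))
          (fun j _ => (hM.eigenvalues_pos j).le) (Finset.mem_univ i)
    _ = _ := by simp

lemma norm_toLp_sq (u : Vec d) : ‖WithLp.toLp 2 u‖ ^ 2 = u ⬝ᵥ u := by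
  rw [EuclideanSpace.norm_sq_eq]
  simp [dotProduct, sq]

end ADA
end

/-! ### Quantizer, innovation and adaptation gains. -/

noncomputable section

namespace ADA

variable {d m : ℕ} {c : ℕ → ℝ}

/-- The thresholds `c 1, …, c m` are ordered. -/
def Ordered (m : ℕ) (c : ℕ → ℝ) : Prop := ∀ i j, 1 ≤ i → i ≤ j → j ≤ m → c i ≤ c j

/-- For ordered thresholds, those lying below `z` form an initial segment, so counting them locates
`z`. This turns events about the observation into events about the noise. -/
lemma quantizer_le_iff (hc : Ordered m c) {i : ℕ} (h1 : 1 ≤ i) (hi : i ≤ m) (z : ℝ) :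
    quantizer m c z ≤ i ↔ z ≤ c i := by
  unfold quantizer
  constructor
  · intro h
    by_contra! hz
    have hsub : Finset.Icc 1 i ⊆ (Finset.Icc 1 m).filter (fun j => c j < z) := by
      intro j hj
      rw [Finset.mem_Icc] at hj
      rw [Finset.mem_filter, Finset.mem_Icc]
      exact ⟨⟨hj.1, hj.2.trans hi⟩, (hc j i hj.1 hj.2 hi).trans_lt hz⟩
    have := Finset.card_le_card hsub
    rw [Nat.card_Icc] at this
    omega
  · intro hz
    have hsub : (Finset.Icc 1 m).filter (fun j => c j < z) ⊆ Finset.Icc 1 (i - 1) := by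
      intro j hj
      rw [Finset.mem_filter, Finset.mem_Icc] at hj
      rw [Finset.mem_Icc]
      refine ⟨hj.1.1, ?_⟩
      by_contra! hlt
      exact absurd (hz.trans (hc i j h1 (by omega) hj.1.2)) (not_le.mpr hj.2)
    have := Finset.card_le_card hsub
    rw [Nat.card_Icc] at this
    omega

lemma one_le_quantizer (z : ℝ) : 1 ≤ quantizer m c z := by unfold quantizer; omega

lemma quantizer_le (z : ℝ) : quantizer m c z ≤ m + 1 := by
  unfold quantizer
  have := Finset.card_filter_le (Finset.Icc 1 m) (fun j => c j < z)
  rw [Nat.card_Icc] at this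
  omega

/-- The indicator that the threshold `c i` bounds the quantization cell of `x`. -/
def adjacent (m : ℕ) (c : ℕ → ℝ) (x : ℝ) (i : ℕ) : ℝ :=
  if quantizer m c x = i ∨ quantizer m c x = i + 1 then 1 else 0

lemma adjacent_nonneg (x : ℝ) (i : ℕ) : 0 ≤ adjacent m c x i := by
  unfold adjacent; split_ifs <;> norm_num

lemma adjacent_le_one (x : ℝ) (i : ℕ) : adjacent m c x i ≤ 1 := by
  unfold adjacent; split_ifs <;> norm_num

/-- Cell `q` has upper endpoint `c q` and lower endpoint `c (q - 1)`. The two conditions discard the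
missing endpoints of the unbounded cells, `q = m + 1` and `q = 1`. -/
lemma sum_adjacent_mul (x : ℝ) (g : ℕ → ℝ) :
    ∑ i ∈ Finset.Icc 1 m, adjacent m c x i * g i =
      (if quantizer m c x ≤ m then g (quantizer m c x) else 0) +
      (if 2 ≤ quantizer m c x then g (quantizer m c x - 1) else 0) := by
  have h1 := one_le_quantizer (m := m) (c := c) x
  have h2 := quantizer_le (m := m) (c := c) x
  set q := quantizer m c x with hq
  have h : ∀ i ∈ Finset.Icc 1 m, adjacent m c x i * g i =
      (if q = i then g i else 0) + (if q - 1 = i then g i else 0) := by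
    intro i hi
    rw [Finset.mem_Icc] at hi
    unfold adjacent
    rw [← hq]
    by_cases ha : q = i
    · have : q - 1 ≠ i := by omega
      simp [ha]
      omega
    · by_cases hb : q = i + 1
      · simp [hb]
      · have : q - 1 ≠ i := by omega
        simp [ha, hb, this]
  rw [Finset.sum_congr rfl h, Finset.sum_add_distrib, Finset.sum_ite_eq, Finset.sum_ite_eq]
  congr 1
  · congr 1; simp [h1]
  · congr 1; simp; omega

/-- As `m ≥ 1`, every cell has at least one finite endpoint; this keeps the gain and the drift away
from zero. -/
lemma one_le_sum_adjacent (hm : 1 ≤ m) (x : ℝ) : 1 ≤ ∑ i ∈ Finset.Icc 1 m, adjacent m c x i := by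
  have h1 := one_le_quantizer (m := m) (c := c) x
  have h := sum_adjacent_mul (m := m) (c := c) x 1
  simp only [Pi.one_apply, mul_one] at h
  rw [h]
  split_ifs <;> first | (norm_num; done) | (exfalso; omega)

lemma abs_sum_adjacent_mul_le {g : ℕ → ℝ} {C : ℝ} (x : ℝ) (hg : ∀ i ∈ Finset.Icc 1 m, |g i| ≤ C) :
    |∑ i ∈ Finset.Icc 1 m, adjacent m c x i * g i| ≤ m * C := by
  refine (Finset.abs_sum_le_sum_abs _ _).trans ?_
  calc _ ≤ ∑ _i ∈ Finset.Icc 1 m, C := Finset.sum_le_sum fun i hi => by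
        rw [abs_mul, abs_of_nonneg (adjacent_nonneg _ _)]
        calc _ ≤ 1 * |g i| := by gcongr; exact adjacent_le_one _ _
          _ ≤ C := by rw [one_mul]; exact hg i hi
    _ = m * C := by simp

lemma le_iff_quantizer_eq_one (hm : 1 ≤ m) (hc : Ordered m c) (x : ℝ) :
    x ≤ c 1 ↔ quantizer m c x = 1 := by
  rw [← quantizer_le_iff hc le_rfl hm]
  have := one_le_quantizer (m := m) (c := c) x
  omega

lemma lt_iff_quantizer_eq (hm : 1 ≤ m) (hc : Ordered m c) (x : ℝ) :
    c m < x ↔ quantizer m c x = m + 1 := by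
  rw [← not_le, ← quantizer_le_iff hc hm le_rfl]
  have := quantizer_le (m := m) (c := c) x
  omega

/-- The sign only records on which side of the current cell the observation falls, so it combines
with the constants in the correction into the indicators `y ≤ i` at the endpoints. This form
replaces the case distinction everywhere below. -/
lemma innovation_eq (hm : 1 ≤ m) {s : Sample d} (hc : Ordered m s.c) (hy1 : 1 ≤ s.y)
    (hy2 : s.y ≤ m + 1) (x : ℝ) :
    innovation m s x = ∑ i ∈ Finset.Icc 1 m,
      adjacent m s.c x i * (s.F (s.c i - x) - if s.y ≤ i then 1 else 0) := by
  rw [sum_adjacent_mul]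
  unfold innovation correction
  simp only [le_iff_quantizer_eq_one hm hc, lt_iff_quantizer_eq hm hc]
  have h1 := one_le_quantizer (m := m) (c := s.c) x
  have h2 := quantizer_le (m := m) (c := s.c) x
  set q := quantizer m s.c x
  have sgn : Real.sign ((s.y : ℝ) - (q : ℝ)) =
      if s.y < q then -1 else if s.y = q then 0 else 1 := by
    rcases lt_trichotomy s.y q with h | h | h
    · rw [if_pos h, Real.sign_of_neg]
      exact sub_neg.mpr (by exact_mod_cast h)
    · rw [if_neg (by omega), if_pos h, h, sub_self, Real.sign_zero]
    · rw [if_neg (by omega), if_neg (by omega), Real.sign_of_pos]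
      exact sub_pos.mpr (by exact_mod_cast h)
  rw [sgn]
  by_cases hq1 : q = 1
  · rw [hq1, if_pos rfl, if_pos hm, if_neg (by omega : ¬ 2 ≤ 1)]
    by_cases hy : s.y = 1
    · simp [hy]
    · rw [if_neg (by omega), if_neg hy, if_neg (by omega)]; ring
  by_cases hqm : q = m + 1
  · rw [if_neg hq1, if_pos hqm, if_neg (by omega : ¬ q ≤ m), if_pos (by omega : 2 ≤ q), hqm,
      Nat.add_sub_cancel]
    by_cases hy : s.y ≤ m
    · rw [if_pos (by omega), if_pos hy]; ring
    · rw [if_neg (by omega), if_pos (by omega), if_neg hy]; ring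
  rw [if_neg hq1, if_neg hqm, if_pos (by omega : q ≤ m), if_pos (by omega : 2 ≤ q)]
  rcases lt_trichotomy s.y q with h | h | h
  · rw [if_pos h, if_pos (by omega), if_pos (by omega)]; ring
  · rw [if_neg (by omega), if_pos h, if_pos (by omega), if_neg (by omega)]; ring
  · rw [if_neg (by omega), if_neg (by omega), if_neg (by omega), if_neg (by omega)]; ring

lemma beta_eq (hm : 1 ≤ m) {s : Sample d} (hc : Ordered m s.c) (x xbar : ℝ) :
    beta m s x xbar = ∑ i ∈ Finset.Icc 1 m, adjacent m s.c x i * slope s.F s.f (s.c i) x xbar := by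
  rw [sum_adjacent_mul]
  unfold beta
  simp only [le_iff_quantizer_eq_one hm hc, lt_iff_quantizer_eq hm hc]
  have h1 := one_le_quantizer (m := m) (c := s.c) x
  have h2 := quantizer_le (m := m) (c := s.c) x
  set q := quantizer m s.c x
  by_cases hq1 : q = 1
  · rw [hq1, if_pos rfl, if_pos hm, if_neg (by omega : ¬ 2 ≤ 1), add_zero]
  by_cases hqm : q = m + 1
  · rw [if_neg hq1, if_pos hqm, if_neg (by omega), if_pos (by omega : 2 ≤ q), hqm,
      Nat.add_sub_cancel, zero_add]
  rw [if_neg hq1, if_neg hqm, if_pos (by omega : q ≤ m), if_pos (by omega : 2 ≤ q), add_comm]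

lemma exists_sub_eq_mul {F f : ℝ → ℝ} (hF : ∀ x, HasDerivAt F (f x) x) (a b : ℝ) :
    ∃ ξ ∈ Set.uIcc a b, F a - F b = f ξ * (a - b) := by
  wlog hab : a ≤ b generalizing a b
  · obtain ⟨ξ, h1, h2⟩ := this b a (le_of_not_ge hab)
    exact ⟨ξ, by rwa [Set.uIcc_comm], by linarith⟩
  rcases hab.eq_or_lt with rfl | hab
  · exact ⟨a, by simp, by simp⟩
  obtain ⟨ξ, h1, h2⟩ := exists_hasDerivAt_eq_slope F f hab
    (fun x _ => (hF x).continuousAt.continuousWithinAt) (fun x _ => hF x)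
  refine ⟨ξ, by rw [Set.uIcc_of_le hab.le]; exact Set.Ioo_subset_Icc_self h1, ?_⟩
  rw [h2]
  have : b - a ≠ 0 := by linarith
  field_simp
  ring

lemma exists_slope_eq {F f : ℝ → ℝ} (hF : ∀ x, HasDerivAt F (f x) x) (t x xbar : ℝ) :
    ∃ ξ ∈ Set.uIcc (t - x) (t - xbar), slope F f t x xbar = f ξ := by
  unfold slope
  by_cases h : xbar - x ≠ 0
  · obtain ⟨ξ, h1, h2⟩ := exists_sub_eq_mul hF (t - x) (t - xbar)
    refine ⟨ξ, h1, ?_⟩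
    rw [if_pos h, h2]
    field_simp
    ring
  · exact ⟨t - x, Set.left_mem_uIcc, by rw [if_neg h]⟩

/-- Clearing the denominator also covers `xbar = x`, where both sides vanish. -/
lemma slope_mul {F f : ℝ → ℝ} (t x xbar : ℝ) :
    slope F f t x xbar * (xbar - x) = F (t - x) - F (t - xbar) := by
  unfold slope
  by_cases h : xbar - x ≠ 0
  · rw [if_pos h]; field_simp
  · rw [if_neg h]
    have : xbar = x := by rw [not_not, sub_eq_zero] at h; exact h
    simp [this]

/-- A distribution function with a continuous density. -/
structure IsLaw (F f : ℝ → ℝ) : Prop where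
  continuous : Continuous f
  nonneg : ∀ x, 0 ≤ f x
  hasDerivAt : ∀ x, HasDerivAt F (f x) x
  cdf_nonneg : ∀ x, 0 ≤ F x
  cdf_le_one : ∀ x, F x ≤ 1

lemma IsLaw.of_integral {F f : ℝ → ℝ} (hf : Continuous f) (h0 : ∀ x, 0 ≤ f x) (hi : Integrable f)
    (h1 : ∫ t, f t = 1) (hF : ∀ x, F x = ∫ t in Set.Iic x, f t) : IsLaw F f where
  continuous := hf
  nonneg := h0
  hasDerivAt x := by
    have h2 : F = fun x => F 0 + ∫ t in (0 : ℝ)..x, f t := by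
      funext y
      rw [hF, hF, ← intervalIntegral.integral_Iic_sub_Iic hi.integrableOn hi.integrableOn]
      ring
    rw [h2]
    exact (intervalIntegral.integral_hasDerivAt_right (hf.intervalIntegrable _ _)
      (hf.stronglyMeasurableAtFilter _ _) hf.continuousAt).const_add _
  cdf_nonneg x := by rw [hF]; exact integral_nonneg h0
  cdf_le_one x := by
    rw [hF, ← h1]
    exact setIntegral_le_integral hi (Eventually.of_forall h0)

/-- The conditions on one step of the data that hold at every sample point. -/
structure Sample.Regular (m : ℕ) (s : Sample d) : Prop where
  ordered : Ordered m s.c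
  law : IsLaw s.F s.f
  one_le_y : 1 ≤ s.y
  y_le : s.y ≤ m + 1
  μbar_pos : 0 < s.μbar
  μ_pos : 0 < s.μ

variable {s : Sample d}

lemma beta_nonneg (hm : 1 ≤ m) (hs : s.Regular m) (x xbar : ℝ) : 0 ≤ beta m s x xbar := by
  rw [beta_eq hm hs.ordered]
  refine Finset.sum_nonneg fun i _ => mul_nonneg (adjacent_nonneg _ _) ?_
  obtain ⟨ξ, _, h⟩ := exists_slope_eq hs.law.hasDerivAt (s.c i) x xbar
  rw [h]
  exact hs.law.nonneg ξ

/-- This needs no sign condition on the radius: over an empty set the real infimum is `0`. -/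
lemma betaBar_nonneg (hs : s.Regular m) : 0 ≤ betaBar m s := by
  apply Real.sInf_nonneg
  rintro _ ⟨x, _, rfl⟩
  exact hs.law.nonneg x

lemma abs_innovation_le (hm : 1 ≤ m) (hs : s.Regular m) (x : ℝ) : |innovation m s x| ≤ m := by
  rw [innovation_eq hm hs.ordered hs.one_le_y hs.y_le]
  refine (abs_sum_adjacent_mul_le (C := 1) x fun i _ => ?_).trans (by simp)
  have h0 := hs.law.cdf_nonneg (s.c i - x)
  have h1 := hs.law.cdf_le_one (s.c i - x)
  rw [abs_le]
  split_ifs <;> constructor <;> linarith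

/-- The conditional mean of the innovation at the prediction `x`, when the noise-free
output is `z`. -/
def drift (m : ℕ) (s : Sample d) (z x : ℝ) : ℝ :=
  ∑ i ∈ Finset.Icc 1 m, adjacent m s.c x i * (s.F (s.c i - x) - s.F (s.c i - z))

/-- The martingale difference part of the innovation. -/
def noise (m : ℕ) (s : Sample d) (z x : ℝ) : ℝ :=
  ∑ i ∈ Finset.Icc 1 m, adjacent m s.c x i * (s.F (s.c i - z) - if s.y ≤ i then 1 else 0)

lemma innovation_eq_drift_add_noise (hm : 1 ≤ m) (hs : s.Regular m) (z x : ℝ) :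
    innovation m s x = drift m s z x + noise m s z x := by
  rw [innovation_eq hm hs.ordered hs.one_le_y hs.y_le, drift, noise, ← Finset.sum_add_distrib]
  refine Finset.sum_congr rfl fun i _ => ?_
  ring

lemma abs_noise_le (hs : s.Regular m) (z x : ℝ) : |noise m s z x| ≤ m := by
  refine (abs_sum_adjacent_mul_le (C := 1) x fun i _ => ?_).trans (by simp)
  have h0 := hs.law.cdf_nonneg (s.c i - z)
  have h1 := hs.law.cdf_le_one (s.c i - z)
  rw [abs_le]
  split_ifs <;> constructor <;> linarith

/-- The bounds on one step of the data that hold at almost every sample point. -/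
structure Sample.Bounded (m : ℕ) (K : Set (Vec d)) (s : Sample d) (R l u : ℝ) : Prop where
  pred : ∀ x ∈ K, |s.φ ⬝ᵥ x| ≤ s.G
  upper : s.G + s.c m ≤ R
  lower : s.G - s.c 1 ≤ R
  density : ∀ x, |x| ≤ R → l ≤ s.f x ∧ s.f x ≤ u

variable {K : Set (Vec d)} {R l u : ℝ}

lemma abs_sub_le_of_mem_uIcc (hs : s.Regular m) {i : ℕ} (hi : i ∈ Finset.Icc 1 m) {x z ξ : ℝ}
    (hx : |x| ≤ s.G) (hz : |z| ≤ s.G) (hξ : ξ ∈ Set.uIcc (s.c i - x) (s.c i - z)) :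
    |ξ| ≤ max (s.G + s.c m) (s.G - s.c 1) := by
  rw [Finset.mem_Icc] at hi
  have h1 := hs.ordered 1 i le_rfl hi.1 hi.2
  have h2 := hs.ordered i m hi.1 hi.2 le_rfl
  rw [abs_le] at hx hz
  rw [Set.mem_uIcc] at hξ
  rw [abs_le, neg_le]
  constructor
  · apply le_max_of_le_right
    rcases hξ with h | h <;> linarith
  · apply le_max_of_le_left
    rcases hξ with h | h <;> linarith

lemma Sample.Bounded.max_le (hb : s.Bounded m K R l u) :
    max (s.G + s.c m) (s.G - s.c 1) ≤ R := _root_.max_le hb.upper hb.lower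

lemma beta_mem_Icc (hm : 1 ≤ m) (hs : s.Regular m) (hb : s.Bounded m K R l u) (hl : 0 < l)
    {x z : ℝ} (hx : |x| ≤ s.G) (hz : |z| ≤ s.G) : l ≤ beta m s x z ∧ beta m s x z ≤ m * u := by
  have key : ∀ i ∈ Finset.Icc 1 m, l ≤ slope s.F s.f (s.c i) x z ∧
      slope s.F s.f (s.c i) x z ≤ u := by
    intro i hi
    obtain ⟨ξ, h1, h2⟩ := exists_slope_eq hs.law.hasDerivAt (s.c i) x z
    rw [h2]
    exact hb.density ξ ((abs_sub_le_of_mem_uIcc hs hi hx hz h1).trans hb.max_le)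
  rw [beta_eq hm hs.ordered]
  constructor
  · calc l = 1 * l := (one_mul l).symm
      _ ≤ (∑ i ∈ Finset.Icc 1 m, adjacent m s.c x i) * l := by
        gcongr; exact one_le_sum_adjacent hm x
      _ ≤ _ := by
        rw [Finset.sum_mul]
        exact Finset.sum_le_sum fun i hi =>
          mul_le_mul_of_nonneg_left (key i hi).1 (adjacent_nonneg _ _)
  · refine (le_abs_self _).trans (abs_sum_adjacent_mul_le x fun i hi => ?_)
    rw [abs_of_nonneg (hl.le.trans (key i hi).1)]
    exact (key i hi).2

lemma betaBar_mem_Icc (hs : s.Regular m) (hb : s.Bounded m K R l u) (hm : 1 ≤ m) (hG : 0 ≤ s.G) :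
    l ≤ betaBar m s ∧ betaBar m s ≤ u := by
  have h1 := hs.ordered 1 m le_rfl hm le_rfl
  have hne : (s.f '' {x : ℝ | |x| ≤ max (s.G + s.c m) (s.G - s.c 1)}).Nonempty := by
    refine ⟨_, 0, ?_, rfl⟩
    rw [Set.mem_ofPred_eq, abs_zero]
    -- The radius is nonnegative: if `c m ≤ 0` then `c 1 ≤ c m ≤ 0`, so the second entry of the
    -- maximum is nonnegative.
    rcases le_total 0 (s.c m) with h | h
    · exact le_max_of_le_left (by linarith)
    · exact le_max_of_le_right (by linarith)
  have hbd : BddBelow (s.f '' {x : ℝ | |x| ≤ max (s.G + s.c m) (s.G - s.c 1)}) := by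
    refine ⟨0, ?_⟩
    rintro _ ⟨x, _, rfl⟩
    exact hs.law.nonneg x
  constructor
  · apply le_csInf hne
    rintro _ ⟨x, hx, rfl⟩
    exact (hb.density x (le_trans hx hb.max_le)).1
  · obtain ⟨_, x, hx, rfl⟩ := hne
    exact (csInf_le hbd ⟨x, hx, rfl⟩).trans (hb.density x (le_trans hx hb.max_le)).2

lemma betaBar_le (hs : s.Regular m) {ξ : ℝ} (hξ : |ξ| ≤ max (s.G + s.c m) (s.G - s.c 1)) :
    betaBar m s ≤ s.f ξ := by
  refine csInf_le ⟨0, ?_⟩ ⟨ξ, hξ, rfl⟩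
  rintro _ ⟨x, _, rfl⟩
  exact hs.law.nonneg x

/-- Each term of the drift is a density value times `z - x`, by the mean value theorem at a point in
the range of the infimum. All terms push in the same direction, and at least one threshold is
present. -/
lemma betaBar_mul_sq_le (hm : 1 ≤ m) (hs : s.Regular m) {x z : ℝ}
    (hx : |x| ≤ s.G) (hz : |z| ≤ s.G) :
    betaBar m s * (z - x) ^ 2 ≤ (z - x) * drift m s z x := by
  unfold drift
  rw [Finset.mul_sum]
  calc _ = 1 * (betaBar m s * (z - x) ^ 2) := (one_mul _).symm
    _ ≤ (∑ i ∈ Finset.Icc 1 m, adjacent m s.c x i) * (betaBar m s * (z - x) ^ 2) := by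
      have := betaBar_nonneg hs
      gcongr
      exact one_le_sum_adjacent hm x
    _ ≤ _ := by
      rw [Finset.sum_mul]
      refine Finset.sum_le_sum fun i hi => ?_
      obtain ⟨ξ, h1, h2⟩ := exists_sub_eq_mul hs.law.hasDerivAt (s.c i - x) (s.c i - z)
      have h3 := betaBar_le hs (abs_sub_le_of_mem_uIcc hs hi hx hz h1)
      have h4 : (z - x) * (adjacent m s.c x i * (s.F (s.c i - x) - s.F (s.c i - z)))
          = adjacent m s.c x i * (s.f ξ * (z - x) ^ 2) := by
        rw [h2]; ring
      rw [h4]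
      have := adjacent_nonneg (m := m) (c := s.c) x i
      gcongr

/-- The secant slopes are designed for this: `β (xbar - x)` replaces `F (c i - z)` by `F (c i -
xbar)` in the drift. What remains depends on the preliminary error `z - xbar` only. -/
lemma abs_drift_sub_le (hm : 1 ≤ m) (hs : s.Regular m) (hb : s.Bounded m K R l u) {x xbar z : ℝ}
    (hxbar : |xbar| ≤ s.G) (hz : |z| ≤ s.G) :
    |drift m s z x - beta m s x xbar * (xbar - x)| ≤ m * (u * |z - xbar|) := by
  have h : drift m s z x - beta m s x xbar * (xbar - x) =
      ∑ i ∈ Finset.Icc 1 m, adjacent m s.c x i * (s.F (s.c i - xbar) - s.F (s.c i - z)) := by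
    rw [beta_eq hm hs.ordered, drift, Finset.sum_mul, ← Finset.sum_sub_distrib]
    refine Finset.sum_congr rfl fun i _ => ?_
    rw [mul_assoc, slope_mul]
    ring
  rw [h]
  refine abs_sum_adjacent_mul_le x fun i hi => ?_
  obtain ⟨ξ, h1, h2⟩ := exists_sub_eq_mul hs.law.hasDerivAt (s.c i - xbar) (s.c i - z)
  have h3 := (hb.density ξ ((abs_sub_le_of_mem_uIcc hs hi hxbar hz h1).trans hb.max_le)).2
  rw [h2, abs_mul, abs_of_nonneg (hs.law.nonneg ξ)]
  have h4 : s.c i - xbar - (s.c i - z) = z - xbar := by ring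
  rw [h4]
  gcongr

end ADA
end

/-! ### Measurability of the algorithm. -/

noncomputable section

namespace ADA

variable {d m : ℕ} {Ω : Type*} {mΩ : MeasurableSpace Ω} {K : Set (Vec d)}

/-- Pairs of a positive definite matrix and a vector. -/
abbrev PosDefPair (d : ℕ) : Type :=
  {p : (Fin d → Fin d → ℝ) × Vec d // (Matrix.of p.1).PosDef}

/-- Along an ultrafilter the projections converge in the compact set `K`. Passing to the limit in
the minimality inequalities shows that the limit is a minimizer, hence the projection by uniqueness.
Continuity is what makes a projection defined by choice measurable. -/
lemma continuous_proj (hK : Convex ℝ K) (hc : IsCompact K) (hne : K.Nonempty) :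
    Continuous fun p : PosDefPair d =>
      proj K (Matrix.of p.1.1) p.1.2 := by
  rw [continuous_iff_ultrafilter]
  intro p U hU
  have hmem : K ∈ U.map (fun p : PosDefPair d => proj K (Matrix.of p.1.1) p.1.2) := by
    change ∀ᶠ q : PosDefPair d in U, proj K (Matrix.of q.1.1) q.1.2 ∈ K
    exact Filter.Eventually.of_forall fun q => (proj_spec hc hne (Matrix.of q.1.1) q.1.2).1
  obtain ⟨y, hy, hUy⟩ := hc.ultrafilter_le_nhds' _ hmem
  have hty : Tendsto (fun p : PosDefPair d =>
      proj K (Matrix.of p.1.1) p.1.2) U (𝓝 y) := hUy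
  suffices h : proj K (Matrix.of p.1.1) p.1.2 = y by rw [h]; exact hty
  obtain ⟨h1, h2⟩ := proj_spec hc hne (Matrix.of p.1.1) p.1.2
  refine isMinimizer_unique hK p.2 hy (fun z hz => ?_) h1 h2
  have hw : Continuous fun q : ((Fin d → Fin d → ℝ) × Vec d) × Vec d =>
      wnormSq (Matrix.of q.1.1) (q.1.2 - q.2) := by
    unfold wnormSq
    have : Continuous fun q : ((Fin d → Fin d → ℝ) × Vec d) × Vec d =>
        (Matrix.of q.1.1 : Mat d) := continuous_fst.fst
    fun_prop
  have hp : Tendsto (fun p : PosDefPair d => p.1)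
      U (𝓝 p.1) := (continuous_subtype_val.tendsto p).comp hU
  refine le_of_tendsto_of_tendsto ((hw.tendsto (p.1, y)).comp (hp.prodMk_nhds hty))
    ((hw.tendsto (p.1, z)).comp (hp.prodMk_nhds tendsto_const_nhds))
    (Filter.Eventually.of_forall fun q => ?_)
  exact (proj_spec hc hne (Matrix.of q.1.1) q.1.2).2 z hz

lemma measurable_proj (hK : Convex ℝ K) (hc : IsCompact K) (hne : K.Nonempty)
    {A : Ω → Mat d} (hA : ∀ i j, Measurable fun ω => A ω i j) (hpos : ∀ ω, (A ω).PosDef)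
    {x : Ω → Vec d} (hx : Measurable x) : Measurable fun ω => proj K (A ω) (x ω) := by
  have h1 : Measurable fun ω => ((fun i j => A ω i j, x ω) : (Fin d → Fin d → ℝ) × Vec d) :=
    Measurable.prodMk
      (measurable_pi_lambda _ fun i => measurable_pi_lambda _ fun j => hA i j) hx
  have h2 : Measurable fun ω => (⟨(fun i j => A ω i j, x ω), hpos ω⟩ : PosDefPair d) :=
    Measurable.subtype_mk h1
  have h3 : Measurable fun p : PosDefPair d => proj K (Matrix.of p.1.1) p.1.2 :=
    (continuous_proj hK hc hne).measurable
  have h4 := h3.comp h2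
  simp only [Function.comp_def] at h4
  exact h4

lemma measurable_of_continuous_entries {A : Ω → Mat d} (hA : ∀ i j, Measurable fun ω => A ω i j)
    {g : Mat d → ℝ} (hg : Continuous g) : Measurable fun ω => g (A ω) := by
  have h1 : Measurable fun ω => (fun i j => A ω i j : Fin d → Fin d → ℝ) :=
    measurable_pi_lambda _ fun i => measurable_pi_lambda _ fun j => hA i j
  have h2 : Continuous fun B : Fin d → Fin d → ℝ => g (Matrix.of B) := hg
  exact h2.measurable.comp h1

lemma measurable_inv_entries {A : Ω → Mat d} (hA : ∀ i j, Measurable fun ω => A ω i j)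
    (i j : Fin d) : Measurable fun ω => (A ω)⁻¹ i j := by
  simp only [Matrix.inv_def, Ring.inverse_eq_inv', Matrix.smul_apply, smul_eq_mul]
  refine Measurable.mul (Measurable.inv ?_) ?_
  · exact measurable_of_continuous_entries hA (g := fun B => B.det) (by fun_prop)
  · exact measurable_of_continuous_entries hA (g := fun B => B.adjugate i j)
      ((continuous_id.matrix_adjugate).matrix_elem i j)

lemma measurable_dotProduct {u v : Ω → Vec d} (hu : Measurable u) (hv : Measurable v) :
    Measurable fun ω => u ω ⬝ᵥ v ω := by
  unfold dotProduct
  exact Finset.measurable_sum _ fun i _ =>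
    ((measurable_pi_apply i).comp hu).mul ((measurable_pi_apply i).comp hv)

lemma measurable_mulVec {A : Ω → Mat d} (hA : ∀ i j, Measurable fun ω => A ω i j)
    {v : Ω → Vec d} (hv : Measurable v) : Measurable fun ω => A ω *ᵥ v ω := by
  refine measurable_pi_lambda _ fun i => ?_
  simp only [mulVec, dotProduct]
  exact Finset.measurable_sum _ fun j _ => (hA i j).mul ((measurable_pi_apply j).comp hv)

lemma measurable_gain {P : Ω → Mat d} (hP : ∀ i j, Measurable fun ω => P ω i j)
    {φ : Ω → Vec d} (hφ : Measurable φ) {μ β : Ω → ℝ} (hμ : Measurable μ) (hβ : Measurable β) :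
    Measurable fun ω => gain (P ω) (φ ω) (μ ω) (β ω) := by
  unfold gain
  exact measurable_const.div (hμ.add (hβ.mul (measurable_dotProduct hφ (measurable_mulVec hP hφ))))

lemma measurable_updateP {P : Ω → Mat d} (hP : ∀ i j, Measurable fun ω => P ω i j)
    {φ : Ω → Vec d} (hφ : Measurable φ) {μ β : Ω → ℝ} (hμ : Measurable μ) (hβ : Measurable β)
    (i j : Fin d) : Measurable fun ω => updateP (P ω) (φ ω) (μ ω) (β ω) i j := by
  have hφi : ∀ i, Measurable fun ω => φ ω i := fun i => (measurable_pi_apply i).comp hφ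
  simp only [updateP, Matrix.sub_apply, Matrix.smul_apply, smul_eq_mul, Matrix.mul_apply,
    vecMulVec_apply]
  refine (hP i j).sub (((measurable_gain hP hφ hμ hβ).mul hβ).mul ?_)
  exact Finset.measurable_sum _ fun k _ => (Finset.measurable_sum _ fun l _ =>
    (hP i l).mul ((hφi l).mul (hφi k))).mul (hP k j)

lemma measurable_updateTheta (hK : Convex ℝ K) (hc : IsCompact K) (hne : K.Nonempty)
    {η : Ω → Vec d} (hη : Measurable η)
    {P : Ω → Mat d} (hP : ∀ i j, Measurable fun ω => P ω i j) (hpos : ∀ ω, (P ω).PosDef)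
    {φ : Ω → Vec d} (hφ : Measurable φ) {μ β v : Ω → ℝ} (hμ : Measurable μ) (hβ : Measurable β)
    (hμ0 : ∀ ω, 0 < μ ω) (hβ0 : ∀ ω, 0 ≤ β ω) (hv : Measurable v) :
    Measurable fun ω => updateTheta K (η ω) (P ω) (φ ω) (μ ω) (β ω) (v ω) := by
  unfold updateTheta
  refine measurable_proj hK hc hne (measurable_inv_entries (measurable_updateP hP hφ hμ hβ))
    (fun ω => posDef_updateP_inv (hpos ω) _ (hμ0 ω) (hβ0 ω)) (hη.add ?_)
  exact ((measurable_gain hP hφ hμ hβ).mul hv).smul (measurable_mulVec hP hφ)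

/-- The quantities known before the observation are measurable. -/
structure MeasurableData (mΩ : MeasurableSpace Ω) (m : ℕ) (s : Ω → Sample d) : Prop where
  regular : ∀ ω, (s ω).Regular m
  φ : Measurable fun ω => (s ω).φ
  c : ∀ i ∈ Finset.Icc 1 m, Measurable fun ω => (s ω).c i
  F : ∀ x, Measurable fun ω => (s ω).F x
  G : Measurable fun ω => (s ω).G
  μbar : Measurable fun ω => (s ω).μbar
  μ : Measurable fun ω => (s ω).μ

namespace MeasurableData

variable {s : Ω → Sample d} (hs : MeasurableData mΩ m s)
include hs

lemma measurable_cdf {x : Ω → ℝ} (hx : Measurable x) : Measurable fun ω => (s ω).F (x ω) := by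
  have h := measurable_uncurry_of_continuous_of_measurable (u := fun (x : ℝ) ω => (s ω).F x)
    (fun ω => continuous_iff_continuousAt.mpr
      fun x => ((hs.regular ω).law.hasDerivAt x).continuousAt) hs.F
  exact h.comp (hx.prodMk measurable_id)

/-- Measurability is assumed for the distribution function only; the density is recovered as the
limit of its difference quotients with step `1 / (n + 1)`. -/
lemma measurable_density {x : Ω → ℝ} (hx : Measurable x) : Measurable fun ω => (s ω).f (x ω) := by
  have hlim : Tendsto (fun n : ℕ => ((n : ℝ) + 1)⁻¹) atTop (𝓝[≠] 0) := by
    refine tendsto_nhdsWithin_iff.mpr ⟨?_, Eventually.of_forall fun n => ?_⟩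
    · simpa using tendsto_one_div_add_atTop_nhds_zero_nat (𝕜 := ℝ)
    · have : (0 : ℝ) < (n : ℝ) + 1 := by positivity
      exact (inv_pos.mpr this).ne'
  refine measurable_of_tendsto_metrizable (f := fun (n : ℕ) ω =>
    ((n : ℝ) + 1)⁻¹⁻¹ * ((s ω).F (x ω + ((n : ℝ) + 1)⁻¹) - (s ω).F (x ω))) (fun n => ?_) ?_
  · exact ((hs.measurable_cdf (hx.add_const _)).sub (hs.measurable_cdf hx)).const_mul _
  · rw [tendsto_pi_nhds]
    intro ω
    have h := hasDerivAt_iff_tendsto_slope_zero.mp ((hs.regular ω).law.hasDerivAt (x ω))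
    exact h.comp hlim

lemma measurable_quantizer {x : Ω → ℝ} (hx : Measurable x) :
    Measurable fun ω => quantizer m (s ω).c (x ω) := by
  simp only [quantizer, Finset.card_filter]
  refine Measurable.add measurable_const (Finset.measurable_sum _ fun i hi => ?_)
  exact Measurable.ite (measurableSet_lt (hs.c i hi) hx) measurable_const measurable_const

lemma measurable_adjacent {x : Ω → ℝ} (hx : Measurable x) (i : ℕ) :
    Measurable fun ω => adjacent m (s ω).c (x ω) i := by
  exact (Measurable.of_discrete (f := fun n : ℕ => if n = i ∨ n = i + 1 then (1 : ℝ) else 0)).comp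
    (hs.measurable_quantizer hx)

lemma measurable_slope {t x xbar : Ω → ℝ} (ht : Measurable t) (hx : Measurable x)
    (hxbar : Measurable xbar) :
    Measurable fun ω => slope (s ω).F (s ω).f (t ω) (x ω) (xbar ω) := by
  unfold slope
  refine Measurable.ite ?_ ?_ (hs.measurable_density (ht.sub hx))
  · exact (measurableSet_eq_fun (hxbar.sub hx) measurable_const).compl
  · exact ((hs.measurable_cdf (ht.sub hx)).sub (hs.measurable_cdf (ht.sub hxbar))).div
      (hxbar.sub hx)

lemma measurable_beta (hm : 1 ≤ m) {x xbar : Ω → ℝ} (hx : Measurable x)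
    (hxbar : Measurable xbar) : Measurable fun ω => beta m (s ω) (x ω) (xbar ω) := by
  simp only [fun ω => beta_eq hm (hs.regular ω).ordered (x ω) (xbar ω)]
  exact Finset.measurable_sum _ fun i hi =>
    (hs.measurable_adjacent hx i).mul (hs.measurable_slope (hs.c i hi) hx hxbar)

lemma measurable_innovation (hm : 1 ≤ m) (hy : Measurable fun ω => (s ω).y) {x : Ω → ℝ}
    (hx : Measurable x) : Measurable fun ω => innovation m (s ω) (x ω) := by
  simp only [fun ω => innovation_eq hm (hs.regular ω).ordered (hs.regular ω).one_le_y
    (hs.regular ω).y_le (x ω)]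
  refine Finset.measurable_sum _ fun i hi => (hs.measurable_adjacent hx i).mul
    ((hs.measurable_cdf ((hs.c i hi).sub hx)).sub ?_)
  exact Measurable.ite (measurableSet_le hy measurable_const) measurable_const measurable_const

lemma measurable_noise (hy : Measurable fun ω => (s ω).y) {x z : Ω → ℝ}
    (hx : Measurable x) (hz : Measurable z) : Measurable fun ω => noise m (s ω) (z ω) (x ω) := by
  refine Finset.measurable_sum _ fun i hi => (hs.measurable_adjacent hx i).mul
    ((hs.measurable_cdf ((hs.c i hi).sub hz)).sub ?_)
  exact Measurable.ite (measurableSet_le hy measurable_const) measurable_const measurable_const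

/-- By continuity of the density, the infimum over `[-r, r]` is a countable infimum over points `t *
r`, with `t` a rational clipped to `[-1, 1]`. The clipping keeps the index set independent of the
sample point. -/
lemma measurable_betaBar (hm : 1 ≤ m) : Measurable fun ω => betaBar m (s ω) := by
  set r : Ω → ℝ := fun ω => max ((s ω).G + (s ω).c m) ((s ω).G - (s ω).c 1) with hr
  have hrm : Measurable r := by
    refine (hs.G.add (hs.c m ?_)).max (hs.G.sub (hs.c 1 ?_)) <;> simp [hm]
  have hclip : ∀ t : ℝ, |max (-1) (min 1 t)| ≤ 1 := by
    intro t
    rw [abs_le]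
    exact ⟨le_max_left _ _, max_le (by norm_num) (min_le_left _ _)⟩
  have key : (fun ω => betaBar m (s ω)) = fun ω =>
      if 0 ≤ r ω then ⨅ q : ℚ, (s ω).f (max (-1) (min 1 (q : ℝ)) * r ω) else 0 := by
    funext ω
    have hlaw := (hs.regular ω).law
    by_cases h0 : 0 ≤ r ω
    · rw [if_pos h0]
      have hbdd : BddBelow (Set.range fun q : ℚ => (s ω).f (max (-1) (min 1 (q : ℝ)) * r ω)) := by
        refine ⟨0, ?_⟩
        rintro _ ⟨q, rfl⟩
        exact hlaw.nonneg _
      apply le_antisymm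
      · refine le_ciInf fun q => betaBar_le (hs.regular ω) ?_
        change _ ≤ r ω
        rw [abs_mul, abs_of_nonneg h0]
        exact mul_le_of_le_one_left h0 (hclip q)
      · refine le_csInf ⟨_, 0, ?_, rfl⟩ ?_
        · rw [Set.mem_ofPred_eq, abs_zero]; exact h0
        rintro _ ⟨x, hx, rfl⟩
        have hx' : |x| ≤ r ω := hx
        have hall : ∀ t : ℝ, (⨅ q : ℚ, (s ω).f (max (-1) (min 1 (q : ℝ)) * r ω)) ≤
            (s ω).f (max (-1) (min 1 t) * r ω) := by
          have hcl : IsClosed {t : ℝ | (⨅ q : ℚ, (s ω).f (max (-1) (min 1 (q : ℝ)) * r ω)) ≤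
              (s ω).f (max (-1) (min 1 t) * r ω)} := by
            have := hlaw.continuous
            exact isClosed_le continuous_const (by fun_prop)
          intro t
          have hd : DenseRange ((↑) : ℚ → ℝ) := Rat.denseRange_cast
          exact hd.induction_on (p := fun t => (⨅ q : ℚ, (s ω).f (max (-1) (min 1 (q : ℝ)) * r ω)) ≤
            (s ω).f (max (-1) (min 1 t) * r ω)) t hcl fun q => ciInf_le hbdd q
        rcases h0.eq_or_lt with h0 | h0
        · have : x = 0 := by rw [← h0] at hx'; exact abs_nonpos_iff.mp hx'
          have h := hall 0
          rw [← h0, mul_zero] at h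
          rw [this, ← h0]
          exact h
        · have h := hall (x / r ω)
          rw [abs_le] at hx'
          rw [min_eq_right ((div_le_one h0).mpr hx'.2), max_eq_right, div_mul_cancel₀ _ h0.ne'] at h
          · exact h
          · rw [le_div_iff₀ h0]; linarith [hx'.1]
    -- A negative radius gives an empty set, whose real infimum is `0`.
    · rw [if_neg h0]
      have : {x : ℝ | |x| ≤ r ω} = ∅ := by
        ext x
        simp only [Set.mem_ofPred_eq, Set.mem_empty_iff_false, iff_false, not_le]
        exact (not_le.mp h0).trans_le (abs_nonneg x)
      change sInf ((s ω).f '' {x : ℝ | |x| ≤ r ω}) = 0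
      rw [this, Set.image_empty, Real.sInf_empty]
  rw [key]
  refine Measurable.ite (measurableSet_le measurable_const hrm) ?_ measurable_const
  exact Measurable.iInf fun q => hs.measurable_density (hrm.const_mul _)

end MeasurableData

/-- A random state of the algorithm is measurable, and its matrices are positive definite. -/
structure MeasurableState (mΩ : MeasurableSpace Ω) (σ : Ω → State d) : Prop where
  θbar : Measurable fun ω => (σ ω).θbar
  Pbar : ∀ i j, Measurable fun ω => (σ ω).Pbar i j
  θ : Measurable fun ω => (σ ω).θ
  P : ∀ i j, Measurable fun ω => (σ ω).P i j
  posDef_Pbar : ∀ ω, (σ ω).Pbar.PosDef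
  posDef_P : ∀ ω, (σ ω).P.PosDef

/-- Positive definiteness is propagated at every sample point, not just almost surely, because
measurability of the projection relies on it. -/
lemma MeasurableState.step (hK : Convex ℝ K) (hc : IsCompact K) (hne : K.Nonempty) (hm : 1 ≤ m)
    {σ : Ω → State d} (hσ : MeasurableState mΩ σ) {s : Ω → Sample d} (hs : MeasurableData mΩ m s)
    (hy : Measurable fun ω => (s ω).y) :
    MeasurableState mΩ fun ω => step m K (s ω) (σ ω) := by
  have hx := measurable_dotProduct hs.φ hσ.θ
  have hxbar := measurable_dotProduct hs.φ hσ.θbar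
  have hβ := hs.measurable_beta hm hx hxbar
  have hβbar := hs.measurable_betaBar hm
  have hβ0 : ∀ ω, 0 ≤ beta m (s ω) ((s ω).φ ⬝ᵥ (σ ω).θ) ((s ω).φ ⬝ᵥ (σ ω).θbar) :=
    fun ω => beta_nonneg hm (hs.regular ω) _ _
  have hβbar0 : ∀ ω, 0 ≤ betaBar m (s ω) := fun ω => betaBar_nonneg (hs.regular ω)
  have hμ0 : ∀ ω, 0 < (s ω).μ := fun ω => (hs.regular ω).μ_pos
  have hμbar0 : ∀ ω, 0 < (s ω).μbar := fun ω => (hs.regular ω).μbar_pos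
  exact
    { θbar := measurable_updateTheta hK hc hne hσ.θbar hσ.Pbar hσ.posDef_Pbar hs.φ hs.μbar hβbar
        hμbar0 hβbar0 (hs.measurable_innovation hm hy hxbar)
      Pbar := measurable_updateP hσ.Pbar hs.φ hs.μbar hβbar
      θ := measurable_updateTheta hK hc hne hσ.θ hσ.P hσ.posDef_P hs.φ hs.μ hβ
        hμ0 hβ0 (hs.measurable_innovation hm hy hx)
      P := measurable_updateP hσ.P hs.φ hs.μ hβ
      posDef_Pbar := fun ω => posDef_updateP (hσ.posDef_Pbar ω) _ (hμbar0 ω) (hβbar0 ω)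
      posDef_P := fun ω => posDef_updateP (hσ.posDef_P ω) _ (hμ0 ω) (hβ0 ω) }

end ADA
end

/-! ### Conditional laws and an exponential supermartingale bound. -/

noncomputable section

namespace ADA

/-- A strict inequality at `r` persists for `F` on one side of `r`, and there a rational contradicts
monotonicity of `H`. -/
lemma eq_of_rat_eq {H F : ℝ → ℝ} (hH : Monotone H) (hF : Continuous F)
    (h : ∀ q : ℚ, H q = F q) (r : ℝ) : H r = F r := by
  apply le_antisymm
  · by_contra! hlt
    have h1 : ∀ᶠ x in 𝓝[>] r, F x < H r :=
      (hF.continuousAt.eventually_lt continuousAt_const hlt).filter_mono nhdsWithin_le_nhds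
    obtain ⟨b, hb, hsub⟩ := mem_nhdsGT_iff_exists_Ioo_subset.mp h1
    obtain ⟨q, hq1, hq2⟩ := exists_rat_btwn (Set.mem_Ioi.mp hb)
    have h2 : F q < H r := hsub ⟨hq1, hq2⟩
    linarith [hH hq1.le, h q]
  · by_contra! hlt
    have h1 : ∀ᶠ x in 𝓝[<] r, H r < F x :=
      (continuousAt_const.eventually_lt hF.continuousAt hlt).filter_mono nhdsWithin_le_nhds
    obtain ⟨b, hb, hsub⟩ := mem_nhdsLT_iff_exists_Ioo_subset.mp h1
    obtain ⟨q, hq1, hq2⟩ := exists_rat_btwn (Set.mem_Iio.mp hb)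
    have h2 : H r < F q := hsub ⟨hq1, hq2⟩
    linarith [hH hq2.le, h q]

variable {Ω : Type*} {𝒢 : MeasurableSpace Ω} [mΩ : MeasurableSpace Ω] {Pr : Measure Ω}

lemma IsCondLaw.isLaw {X : Ω → ℝ} {F f : Ω → ℝ → ℝ}
    (h : IsCondLaw Pr 𝒢 X F f) (ω : Ω) : IsLaw (F ω) (f ω) :=
  IsLaw.of_integral (h.density_continuous ω) (h.density_nonneg ω) (h.density_integrable ω)
    (h.density_integral ω) (h.cdf_eq ω)

lemma IsCondLaw.measurable_comp {X : Ω → ℝ} {F f : Ω → ℝ → ℝ}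
    (h : IsCondLaw Pr 𝒢 X F f) {T : Ω → ℝ} (hT : Measurable[𝒢] T) :
    Measurable[𝒢] fun ω => F ω (T ω) := by
  have h1 := measurable_uncurry_of_continuous_of_measurable (m := 𝒢) (u := fun (x : ℝ) ω => F ω x)
    (fun ω => continuous_iff_continuousAt.mpr
      fun x => ((h.isLaw ω).hasDerivAt x).continuousAt) h.measurable_cdf
  exact h1.comp (hT.prodMk measurable_id)

variable [IsProbabilityMeasure Pr]

/-- The hypothesis identifies `F` at each fixed argument with its own null set. Uniting the null
sets over the rationals gives one null set valid for all arguments, as needed for random thresholds.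
-/
lemma IsCondLaw.condDistrib_Iic (h𝒢 : 𝒢 ≤ mΩ) {X : Ω → ℝ}
    (hX : Measurable X) {F f : Ω → ℝ → ℝ} (h : IsCondLaw Pr 𝒢 X F f) :
    ∀ᵐ ω ∂Pr, ∀ r : ℝ,
      (@condDistrib Ω Ω ℝ _ _ _ _ 𝒢 X id Pr _ ω).real (Set.Iic r) = F ω r := by
  have hid : @Measurable Ω Ω mΩ 𝒢 id := measurable_id'' h𝒢
  have hq : ∀ q : ℚ, ∀ᵐ ω ∂Pr,
      (@condDistrib Ω Ω ℝ _ _ _ _ 𝒢 X id Pr _ ω).real (Set.Iic (q : ℝ)) = F ω q := by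
    intro q
    have h1 := condDistrib_ae_eq_condExp (μ := Pr) (mβ := 𝒢) hid hX
      (measurableSet_Iic (a := (q : ℝ)))
    rw [MeasurableSpace.comap_id] at h1
    filter_upwards [h1, h.condProb q] with ω h2 h3
    exact h2.trans h3
  filter_upwards [ae_all_iff.mpr hq] with ω hω r
  refine eq_of_rat_eq (H := fun r => (@condDistrib Ω Ω ℝ _ _ _ _ 𝒢 X id Pr _ ω).real (Set.Iic r))
    (fun a b hab => measureReal_mono (Set.Iic_subset_Iic.mpr hab)) ?_ hω r
  exact continuous_iff_continuousAt.mpr fun x => ((h.isLaw ω).hasDerivAt x).continuousAt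

/-- Conditionally on `𝒢` the threshold `T` is frozen, so the indicator integrates to `F` at `T`
under the regular conditional distribution. -/
lemma IsCondLaw.integral_mul_eq_zero (h𝒢 : 𝒢 ≤ mΩ) {X : Ω → ℝ}
    (hX : Measurable X) {F f : Ω → ℝ → ℝ} (h : IsCondLaw Pr 𝒢 X F f) {T Z : Ω → ℝ}
    (hT : Measurable[𝒢] T) (hZ : Measurable[𝒢] Z) {C : ℝ} (hC : ∀ ω, |Z ω| ≤ C) :
    ∫ ω, Z ω * (F ω (T ω) - if X ω ≤ T ω then 1 else 0) ∂Pr = 0 := by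
  have hid : @Measurable Ω Ω mΩ 𝒢 id := measurable_id'' h𝒢
  have hZm : Measurable Z := hZ.mono h𝒢 le_rfl
  have hTm : Measurable T := hT.mono h𝒢 le_rfl
  have hFm : Measurable fun ω => F ω (T ω) := (h.measurable_comp hT).mono h𝒢 le_rfl
  have hi1 : Integrable (fun ω => Z ω * F ω (T ω)) Pr := by
    refine Integrable.of_bound (hZm.mul hFm).aestronglyMeasurable C (ae_of_all _ fun ω => ?_)
    rw [Real.norm_eq_abs, abs_mul, abs_of_nonneg ((h.isLaw ω).cdf_nonneg _)]
    exact (mul_le_of_le_one_right (abs_nonneg _) ((h.isLaw ω).cdf_le_one _)).trans (hC ω)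
  have hi2 : Integrable (fun ω => Z ω * if X ω ≤ T ω then 1 else 0) Pr := by
    refine Integrable.of_bound (hZm.mul (Measurable.ite (measurableSet_le hX hTm)
      measurable_const measurable_const)).aestronglyMeasurable C (ae_of_all _ fun ω => ?_)
    rw [Real.norm_eq_abs, abs_mul]
    refine (mul_le_of_le_one_right (abs_nonneg _) ?_).trans (hC ω)
    split_ifs <;> simp
  have hg : @StronglyMeasurable (Ω × ℝ) ℝ _ (@Prod.instMeasurableSpace Ω ℝ 𝒢 _)
      (fun p => Z p.1 * if p.2 ≤ T p.1 then 1 else 0) := by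
    refine Measurable.stronglyMeasurable ?_
    refine Measurable.mul (hZ.comp measurable_fst) (Measurable.ite ?_ measurable_const
      measurable_const)
    exact measurableSet_le measurable_snd (hT.comp measurable_fst)
  have h1 := condExp_prod_ae_eq_integral_condDistrib (μ := Pr) (mβ := 𝒢) hid hX.aemeasurable hg hi2
  rw [MeasurableSpace.comap_id] at h1
  have h2 : ∫ ω, Z ω * (if X ω ≤ T ω then 1 else 0) ∂Pr = ∫ ω, Z ω * F ω (T ω) ∂Pr := by
    rw [← integral_condExp h𝒢]
    refine integral_congr_ae ?_
    filter_upwards [h1, h.condDistrib_Iic h𝒢 hX] with ω h3 h4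
    refine h3.trans ?_
    rw [← h4 (T ω), integral_const_mul]
    congr 1
    have h5 : (fun y : ℝ => if y ≤ T (id ω) then (1 : ℝ) else 0) =
        (Set.Iic (T ω)).indicator 1 := by
      funext y
      simp [Set.indicator_apply]
    rw [h5, integral_indicator_one measurableSet_Iic]
    rfl
  simp only [mul_sub]
  rw [integral_sub hi1 hi2, h2, sub_self]

/-- Hoeffding's chord bound: `w` is a convex combination of `C` and `-C`. The bound is affine in
`w`, so its mean is computable when `w` is centred. -/
lemma exp_mul_le_cosh_add {C w : ℝ} (hC : 0 < C) (hw : |w| ≤ C) (g : ℝ) :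
    Real.exp (g * w) ≤ Real.cosh (g * C) + w / C * Real.sinh (g * C) := by
  rw [abs_le] at hw
  have h1 : 0 ≤ (1 + w / C) / 2 := by
    have : -1 ≤ w / C := by rw [le_div_iff₀ hC]; linarith
    linarith
  have h2 : 0 ≤ (1 - w / C) / 2 := by
    have : w / C ≤ 1 := by rw [div_le_iff₀ hC]; linarith
    linarith
  have h := convexOn_exp.2 (Set.mem_univ (g * C)) (Set.mem_univ (-(g * C))) h1 h2 (by ring)
  simp only [smul_eq_mul] at h
  have h3 : (1 + w / C) / 2 * (g * C) + (1 - w / C) / 2 * -(g * C) = g * w := by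
    field_simp
    ring
  rw [h3] at h
  rw [Real.cosh_eq, Real.sinh_eq]
  linarith

lemma abs_sinh_le_exp (x : ℝ) : |Real.sinh x| ≤ Real.exp (x ^ 2 / 2) := by
  refine le_trans ?_ (Real.cosh_le_exp_half_sq x)
  rw [Real.cosh_eq, Real.sinh_eq, abs_le]
  have := Real.exp_pos x
  have := Real.exp_pos (-x)
  constructor <;> linarith

/-- Bounded martingale differences with predictable weights: the weighted sums are dominated by the
sums of the squared weights. -/
theorem ae_exists_sum_mul_le (ℱ : Filtration ℕ mΩ) {w g : ℕ → Ω → ℝ} {C : ℝ} (hC : 0 < C)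
    (hw : ∀ k ω, |w k ω| ≤ C) (hwm : ∀ k, Measurable[ℱ (k + 1)] (w k))
    (hgm : ∀ k, Measurable[ℱ k] (g k))
    (h0 : ∀ k (Z : Ω → ℝ), Measurable[ℱ k] Z → (∃ B, ∀ ω, |Z ω| ≤ B) →
      ∫ ω, Z ω * w k ω ∂Pr = 0) :
    ∀ᵐ ω ∂Pr, ∃ B : ℝ, ∀ n, ∑ i ∈ Finset.range n, g i ω * w i ω ≤
      C ^ 2 / 2 * ∑ i ∈ Finset.range n, g i ω ^ 2 + B := by
  set S : ℕ → Ω → ℝ := fun n ω =>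
    ∑ i ∈ Finset.range n, (g i ω * w i ω - C ^ 2 * g i ω ^ 2 / 2) with hS
  set M : ℕ → Ω → ℝ := fun n ω => Real.exp (S n ω) with hM
  have hSm : ∀ n, Measurable[ℱ n] (S n) := by
    intro n
    refine Finset.measurable_sum _ fun i hi => ?_
    rw [Finset.mem_range] at hi
    have hg : Measurable[ℱ n] (g i) := (hgm i).mono (ℱ.mono hi.le) le_rfl
    have hw : Measurable[ℱ n] (w i) := (hwm i).mono (ℱ.mono hi) le_rfl
    exact (hg.mul hw).sub (((hg.pow_const 2).const_mul _).div_const _)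
  have hMm : ∀ n, Measurable[ℱ n] (M n) := fun n => Real.measurable_exp.comp (hSm n)
  -- Each summand is at most `t - t²/2 ≤ 1/2` with `t = |g i| C`. Hence the exponentials are
  -- integrable even for unbounded weights `g`.
  have hSle : ∀ n ω, S n ω ≤ n / 2 := by
    intro n ω
    calc _ ≤ ∑ _i ∈ Finset.range n, (1 / 2 : ℝ) := by
          refine Finset.sum_le_sum fun i _ => ?_
          have h1 : g i ω * w i ω ≤ |g i ω| * C := by
            refine (le_abs_self _).trans ?_
            rw [abs_mul]
            gcongr
            exact hw i ω
          nlinarith [sq_nonneg (|g i ω| * C - 1), sq_abs (g i ω)]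
      _ = n / 2 := by simp; ring
  have hMpos : ∀ n ω, 0 < M n ω := fun n ω => Real.exp_pos _
  have hMle : ∀ n ω, M n ω ≤ Real.exp (n / 2) := fun n ω => Real.exp_le_exp.mpr (hSle n ω)
  have hMi : ∀ n, Integrable (M n) Pr := fun n =>
    Integrable.of_bound ((hMm n).mono (ℱ.le n) le_rfl).aestronglyMeasurable (Real.exp (n / 2))
      (ae_of_all _ fun ω => by
        rw [Real.norm_eq_abs, abs_of_pos (hMpos n ω)]; exact hMle n ω)
  -- The coefficient of `w n` in the chord bound. It is predictable, and bounded because the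
  -- Gaussian factor compensates the hyperbolic sine, so the centring hypothesis applies to it.
  set Z : ℕ → Ω → ℝ := fun n ω =>
    M n ω * Real.exp (-((g n ω * C) ^ 2 / 2)) * Real.sinh (g n ω * C) / C with hZ
  have hZm : ∀ n, Measurable[ℱ n] (Z n) := by
    intro n
    have hg : Measurable[ℱ n] fun ω => g n ω * C := (hgm n).mul_const C
    exact (((hMm n).mul (Real.measurable_exp.comp ((hg.pow_const 2).div_const 2).neg)).mul
      (Real.measurable_sinh.comp hg)).div_const C
  have hZb : ∀ n ω, |Z n ω| ≤ Real.exp (n / 2) / C := by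
    intro n ω
    simp only [hZ]
    rw [abs_div, abs_of_pos hC, abs_mul, abs_mul, abs_of_pos (hMpos n ω), Real.abs_exp]
    gcongr
    calc _ ≤ Real.exp (n / 2) * Real.exp (-((g n ω * C) ^ 2 / 2)) *
          Real.exp ((g n ω * C) ^ 2 / 2) := by
          gcongr
          · exact hMle n ω
          · exact abs_sinh_le_exp _
      _ = _ := by rw [mul_assoc, ← Real.exp_add]; simp
  have hstep : ∀ n ω, M (n + 1) ω ≤ M n ω + Z n ω * w n ω := by
    intro n ω
    have e : M (n + 1) ω =
        M n ω * Real.exp (-((g n ω * C) ^ 2 / 2)) * Real.exp (g n ω * w n ω) := by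
      simp only [hM, hS]
      rw [← Real.exp_add, ← Real.exp_add, Finset.sum_range_succ]
      congr 1
      ring
    have h1 := exp_mul_le_cosh_add hC (hw n ω) (g n ω)
    have h2 := Real.cosh_le_exp_half_sq (g n ω * C)
    have h3 : Real.exp (-((g n ω * C) ^ 2 / 2)) * Real.exp ((g n ω * C) ^ 2 / 2) = 1 := by
      rw [← Real.exp_add]; simp
    rw [e]
    have hp := hMpos n ω
    calc _ ≤ M n ω * Real.exp (-((g n ω * C) ^ 2 / 2)) *
          (Real.exp ((g n ω * C) ^ 2 / 2) + w n ω / C * Real.sinh (g n ω * C)) := by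
          gcongr
          linarith
      _ = M n ω * (Real.exp (-((g n ω * C) ^ 2 / 2)) * Real.exp ((g n ω * C) ^ 2 / 2)) +
          Z n ω * w n ω := by
          simp only [hZ]
          ring
      _ = _ := by rw [h3, mul_one]
  have hsup : Supermartingale M ℱ Pr := by
    refine supermartingale_of_setIntegral_succ_le (fun n => (hMm n).stronglyMeasurable) hMi
      fun n s hs => ?_
    have hs' : MeasurableSet s := ℱ.le n s hs
    have hZw : Integrable (fun ω => Z n ω * w n ω) Pr := by
      refine Integrable.of_bound (((hZm n).mono (ℱ.le n) le_rfl).mul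
        ((hwm n).mono (ℱ.le _) le_rfl)).aestronglyMeasurable (Real.exp (n / 2) / C * C)
        (ae_of_all _ fun ω => ?_)
      rw [Real.norm_eq_abs, abs_mul]
      gcongr
      · exact hZb n ω
      · exact hw n ω
    have h1 : ∫ ω in s, Z n ω * w n ω ∂Pr = 0 := by
      rw [← integral_indicator hs', ← h0 n (s.indicator (Z n)) ((hZm n).indicator hs)
        ⟨Real.exp (n / 2) / C, fun ω => ?_⟩]
      · congr 1
        funext ω
        by_cases hω : ω ∈ s <;> simp [hω]
      · by_cases hω : ω ∈ s
        · simpa [hω] using hZb n ω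
        · simp only [hω, not_false_eq_true, Set.indicator_of_notMem, abs_zero]
          positivity
    calc _ ≤ ∫ ω in s, (M n ω + Z n ω * w n ω) ∂Pr :=
          setIntegral_mono (hMi _).integrableOn ((hMi n).add hZw).integrableOn fun ω => hstep n ω
      _ = _ := by
          rw [integral_add (hMi n).integrableOn hZw.integrableOn, h1, add_zero]
  have hint : ∀ n, ∫ ω, M n ω ∂Pr ≤ 1 := by
    intro n
    have h := hsup.setIntegral_le (Nat.zero_le n) MeasurableSet.univ
    rw [setIntegral_univ, setIntegral_univ] at h
    refine h.trans (le_of_eq ?_)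
    simp [hM, hS]
  -- The negated process is an `L¹`-bounded submartingale, so it converges almost surely. Its paths
  -- are therefore bounded, and `S n + 1 ≤ exp (S n)` bounds the exponents from above.
  have hconv := hsup.neg.exists_ae_tendsto_of_bdd (R := 1) fun n => by
    rw [Pi.neg_apply, eLpNorm_neg, eLpNorm_one_eq_lintegral_enorm,
      ← ofReal_integral_norm_eq_lintegral_enorm (hMi n)]
    have : ∫ ω, ‖M n ω‖ ∂Pr ≤ 1 := by
      simpa [abs_of_pos (hMpos n _)] using hint n
    simpa using ENNReal.ofReal_le_ofReal this
  filter_upwards [hconv] with ω ⟨a, ha⟩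
  obtain ⟨b, hb⟩ := ha.bddBelow_range
  refine ⟨-b, fun n => ?_⟩
  have h1 : b ≤ -M n ω := hb ⟨n, rfl⟩
  have h2 : S n ω + 1 ≤ M n ω := Real.add_one_le_exp _
  have h3 : S n ω = ∑ i ∈ Finset.range n, g i ω * w i ω -
      C ^ 2 / 2 * ∑ i ∈ Finset.range n, g i ω ^ 2 := by
    simp only [hS]
    rw [Finset.sum_sub_distrib, Finset.mul_sum]
    congr 1
    refine Finset.sum_congr rfl fun i _ => ?_
    ring
  linarith

/-- Scaling the weights by `1/(j+1)` scales the quadratic side by its square, so dividing back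
multiplies the constant `C²/2` by `1/(j+1)`. Countably many `j` serve all `δ` outside one null set.
-/
theorem ae_forall_exists_sum_mul_le (ℱ : Filtration ℕ mΩ) {w g : ℕ → Ω → ℝ} {C : ℝ} (hC : 0 < C)
    (hw : ∀ k ω, |w k ω| ≤ C) (hwm : ∀ k, Measurable[ℱ (k + 1)] (w k))
    (hgm : ∀ k, Measurable[ℱ k] (g k))
    (h0 : ∀ k (Z : Ω → ℝ), Measurable[ℱ k] Z → (∃ B, ∀ ω, |Z ω| ≤ B) →
      ∫ ω, Z ω * w k ω ∂Pr = 0) :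
    ∀ᵐ ω ∂Pr, ∀ δ > 0, ∃ B : ℝ, ∀ n, ∑ i ∈ Finset.range n, g i ω * w i ω ≤
      δ * ∑ i ∈ Finset.range n, g i ω ^ 2 + B := by
  have h : ∀ j : ℕ, ∀ᵐ ω ∂Pr, ∃ B : ℝ, ∀ n,
      ∑ i ∈ Finset.range n, (((j : ℝ) + 1)⁻¹ * g i ω) * w i ω ≤
      C ^ 2 / 2 * ∑ i ∈ Finset.range n, (((j : ℝ) + 1)⁻¹ * g i ω) ^ 2 + B := fun j =>
    ae_exists_sum_mul_le ℱ hC hw hwm (fun k => (hgm k).const_mul _) h0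
  filter_upwards [ae_all_iff.mpr h] with ω hω δ hδ
  obtain ⟨j, hj⟩ := exists_nat_gt (C ^ 2 / 2 / δ)
  obtain ⟨B, hB⟩ := hω j
  refine ⟨((j : ℝ) + 1) * B, fun n => ?_⟩
  have hn := hB n
  have hj0 : (0 : ℝ) < (j : ℝ) + 1 := by positivity
  simp only [mul_pow, mul_assoc] at hn
  rw [← Finset.mul_sum, ← Finset.mul_sum, inv_mul_le_iff₀ hj0] at hn
  refine hn.trans ?_
  have hS : 0 ≤ ∑ i ∈ Finset.range n, g i ω ^ 2 := Finset.sum_nonneg fun i _ => sq_nonneg _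
  have h1 : C ^ 2 / 2 * ((j : ℝ) + 1)⁻¹ ≤ δ := by
    rw [← div_eq_mul_inv, div_le_iff₀ hj0]
    rw [div_lt_iff₀ hδ] at hj
    nlinarith
  calc _ = (C ^ 2 / 2 * ((j : ℝ) + 1)⁻¹) * ∑ i ∈ Finset.range n, g i ω ^ 2 +
        ((j : ℝ) + 1) * B := by
        field_simp
    _ ≤ _ := by gcongr

end ADA
end

/-! ### Energy estimates along a sample path. -/

noncomputable section

namespace ADA

variable {d m : ℕ} {K : Set (Vec d)}

lemma wnormSq_add_sum (A : Mat d) (t : ℕ → ℝ) (φ : ℕ → Vec d) (n : ℕ) (z : Vec d) :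
    wnormSq (A + ∑ i ∈ Finset.range n, t i • vecMulVec (φ i) (φ i)) z =
      wnormSq A z + ∑ i ∈ Finset.range n, t i * (φ i ⬝ᵥ z) ^ 2 := by
  induction n with
  | zero => simp
  | succ n ih =>
    rw [Finset.sum_range_succ, ← add_assoc, wnormSq_add_smul_vecMulVec, ih, Finset.sum_range_succ,
      add_assoc]

lemma trace_add_sum (A : Mat d) (t : ℕ → ℝ) (φ : ℕ → Vec d) (n : ℕ) :
    (A + ∑ i ∈ Finset.range n, t i • vecMulVec (φ i) (φ i)).trace =
      A.trace + ∑ i ∈ Finset.range n, t i * (φ i ⬝ᵥ φ i) := by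
  simp [trace_sum, trace_vecMulVec]

lemma posDef_add_sum {A : Mat d} (hA : A.PosDef) {t : ℕ → ℝ} (ht : ∀ i, 0 ≤ t i)
    (φ : ℕ → Vec d) (n : ℕ) :
    (A + ∑ i ∈ Finset.range n, t i • vecMulVec (φ i) (φ i)).PosDef := by
  induction n with
  | zero => simpa using hA
  | succ n ih =>
    rw [Finset.sum_range_succ, ← add_assoc]
    exact posDef_add_smul_vecMulVec ih (ht n) _

lemma infoMatrix_eq (P₀ : Mat d) (φ : ℕ → Vec d) (k : ℕ) :
    infoMatrix P₀ φ k =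
      P₀⁻¹ + ∑ i ∈ Finset.range (k + 1), (1 : ℝ) • vecMulVec (φ i) (φ i) := by
  simp [infoMatrix]

lemma posDef_infoMatrix {P₀ : Mat d} (hP₀ : P₀.PosDef) (φ : ℕ → Vec d) (k : ℕ) :
    (infoMatrix P₀ φ k).PosDef := by
  rw [infoMatrix_eq]
  exact posDef_add_sum hP₀.inv (fun _ => zero_le_one) φ _

lemma lamMax_infoMatrix_mono (hd : 1 ≤ d) {P₀ : Mat d} (hP₀ : P₀.PosDef) (φ : ℕ → Vec d) :
    Monotone fun k => lamMax (infoMatrix P₀ φ k) := by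
  refine monotone_nat_of_le_succ fun k => ?_
  refine lamMax_le_lamMax hd (posDef_infoMatrix hP₀ φ k).1 (posDef_infoMatrix hP₀ φ _).1 fun u => ?_
  rw [infoMatrix_eq, infoMatrix_eq, wnormSq_add_sum, wnormSq_add_sum,
    Finset.sum_range_succ _ (k + 1)]
  have : 0 ≤ (φ (k + 1) ⬝ᵥ u) ^ 2 := sq_nonneg _
  linarith

section Recursion

variable {P : ℕ → Mat d} {η φ : ℕ → Vec d} {μ β v ψ w e : ℕ → ℝ} {θ : Vec d} {C a b l u κ : ℝ}

lemma posDef_of_recursion (hP0 : (P 0).PosDef)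
    (hP : ∀ k, P (k + 1) = updateP (P k) (φ k) (μ k) (β k)) (hμ : ∀ k, 0 < μ k)
    (hβ : ∀ k, 0 ≤ β k) (n : ℕ) : (P n).PosDef := by
  induction n with
  | zero => exact hP0
  | succ n ih => rw [hP]; exact posDef_updateP ih _ (hμ n) (hβ n)

lemma inv_of_recursion (hP0 : (P 0).PosDef)
    (hP : ∀ k, P (k + 1) = updateP (P k) (φ k) (μ k) (β k)) (hμ : ∀ k, 0 < μ k)
    (hβ : ∀ k, 0 ≤ β k) (n : ℕ) :
    (P n)⁻¹ = (P 0)⁻¹ + ∑ i ∈ Finset.range n, (β i / μ i) • vecMulVec (φ i) (φ i) := by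
  induction n with
  | zero => simp
  | succ n ih =>
    rw [Finset.sum_range_succ, ← add_assoc, ← ih, hP,
      updateP_inv (posDef_of_recursion hP0 hP hμ hβ n) _ (hμ n) (hβ n)]

/-- The Lyapunov inequality of the projected recursion, accumulated over time. -/
lemma exists_energy_le (hK : Convex ℝ K) (hc : IsCompact K) (hθ : θ ∈ K) (hP0 : (P 0).PosDef)
    (hP : ∀ k, P (k + 1) = updateP (P k) (φ k) (μ k) (β k))
    (hη : ∀ k, η (k + 1) = updateTheta K (η k) (P k) (φ k) (μ k) (β k) (v k))
    (hv : ∀ k, v k = ψ k + w k) (hvC : ∀ k, |v k| ≤ C) (ha : 0 < a)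
    (hμ : ∀ k, a ≤ μ k ∧ μ k ≤ b) (hl : 0 < l) (hβ : ∀ k, l ≤ β k) (hκ : 0 < κ)
    (he : ∀ k, 0 ≤ e k)
    (hdrift : ∀ k, β k * (φ k ⬝ᵥ (θ - η k)) ^ 2 - 2 * (φ k ⬝ᵥ (θ - η k)) * ψ k ≤
      -(κ * (φ k ⬝ᵥ (θ - η k)) ^ 2) + e k)
    (hnoise : ∀ δ > 0, ∃ B : ℝ, ∀ n, ∑ i ∈ Finset.range n, -((φ i ⬝ᵥ (θ - η i)) / μ i) * w i ≤
      δ * ∑ i ∈ Finset.range n, (-((φ i ⬝ᵥ (θ - η i)) / μ i)) ^ 2 + B) :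
    ∃ C₀ C₁ : ℝ, 0 ≤ C₁ ∧ ∀ n, wnormSq (P n)⁻¹ (θ - η n) +
      κ / (2 * b) * ∑ i ∈ Finset.range n, (φ i ⬝ᵥ (θ - η i)) ^ 2 ≤
      C₀ + 1 / a * ∑ i ∈ Finset.range n, e i + C₁ * Real.log (P n)⁻¹.det := by
  have hb : 0 < b := ha.trans_le ((hμ 0).1.trans (hμ 0).2)
  have hμ0 : ∀ k, 0 < μ k := fun k => ha.trans_le (hμ k).1
  have hβ0 : ∀ k, 0 ≤ β k := fun k => hl.le.trans (hβ k)
  have hPpos := posDef_of_recursion hP0 hP hμ0 hβ0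
  set x : ℕ → ℝ := fun k => φ k ⬝ᵥ (θ - η k) with hx
  have hC : 0 ≤ C := (abs_nonneg _).trans (hvC 0)
  have hstep : ∀ k, wnormSq (P (k + 1))⁻¹ (θ - η (k + 1)) ≤ wnormSq (P k)⁻¹ (θ - η k)
      - κ / b * x k ^ 2 + 1 / a * e k + 2 * (-(x k / μ k) * w k)
      + C ^ 2 / (a * l) * (Real.log (P (k + 1))⁻¹.det - Real.log (P k)⁻¹.det) := by
    intro k
    have h1 := wnormSq_updateTheta_le hK hc (hPpos k) (φ k) (hμ0 k) (hβ0 k) hθ (η k) (v k)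
    have h2 := quadratic_le_log_det (hPpos k) (φ k) (hμ0 k) (hβ0 k)
    rw [← hη, ← hP] at h1
    rw [← hP] at h2
    have hq : 0 ≤ φ k ⬝ᵥ (P (k + 1) *ᵥ φ k) := wnormSq_nonneg (hPpos (k + 1)).posSemidef _
    set q := φ k ⬝ᵥ (P (k + 1) *ᵥ φ k)
    have hβp : 0 < β k := hl.trans_le (hβ k)
    have h3 : (v k / μ k) ^ 2 * q ≤
        C ^ 2 / (a * l) * (Real.log (P (k + 1))⁻¹.det - Real.log (P k)⁻¹.det) := by
      calc (v k / μ k) ^ 2 * q = v k ^ 2 / (μ k * β k) * (β k / μ k * q) := by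
            have := (hμ0 k).ne'
            field_simp
        _ ≤ C ^ 2 / (a * l) * (β k / μ k * q) := by
            have := hμ0 k
            have h4 : v k ^ 2 ≤ C ^ 2 := by
              rw [← sq_abs]
              gcongr
              exact hvC k
            gcongr
            · exact (hμ k).1
            · exact hβ k
        _ ≤ _ := by gcongr
    -- After division by `μ k`, the dissipation is bounded using `μ k ≤ b` and the error input using
    -- `μ k ≥ a`.
    have h5 : β k / μ k * x k ^ 2 - 2 / μ k * x k * ψ k ≤ -(κ / b * x k ^ 2) + 1 / a * e k := by
      calc β k / μ k * x k ^ 2 - 2 / μ k * x k * ψ k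
          = 1 / μ k * (β k * x k ^ 2 - 2 * x k * ψ k) := by
            have := (hμ0 k).ne'
            field_simp
        _ ≤ 1 / μ k * (-(κ * x k ^ 2) + e k) := by
            have := hμ0 k
            gcongr
            exact hdrift k
        _ = -(κ * x k ^ 2 * (1 / μ k)) + 1 / μ k * e k := by ring
        _ ≤ -(κ * x k ^ 2 * (1 / b)) + 1 / a * e k := by
            have := hμ0 k
            have := he k
            gcongr
            · exact (hμ k).2
            · exact (hμ k).1
        _ = _ := by ring
    have h6 : 2 / μ k * x k * v k = 2 / μ k * x k * ψ k - 2 * (-(x k / μ k) * w k) := by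
      rw [hv]
      ring
    linarith
  have hsum : ∀ n, wnormSq (P n)⁻¹ (θ - η n) + κ / b * ∑ i ∈ Finset.range n, x i ^ 2 ≤
      wnormSq (P 0)⁻¹ (θ - η 0) + 1 / a * ∑ i ∈ Finset.range n, e i
      + 2 * ∑ i ∈ Finset.range n, -(x i / μ i) * w i
      + C ^ 2 / (a * l) * (Real.log (P n)⁻¹.det - Real.log (P 0)⁻¹.det) := by
    intro n
    induction n with
    | zero => simp
    | succ n ih =>
      rw [Finset.sum_range_succ, Finset.sum_range_succ, Finset.sum_range_succ, mul_add, mul_add,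
        mul_add]
      have := hstep n
      linarith
  -- Since `μ i ≥ a`, this `δ` bounds the noise by `κ/(4b) ∑ x i²` plus a constant. The noise enters
  -- twice, so half of the dissipation `κ/b` survives.
  obtain ⟨B, hB⟩ := hnoise (κ * a ^ 2 / (4 * b)) (by positivity)
  refine ⟨wnormSq (P 0)⁻¹ (θ - η 0) + 2 * B - C ^ 2 / (a * l) * Real.log (P 0)⁻¹.det,
    C ^ 2 / (a * l), by positivity, fun n => ?_⟩
  have h1 := hsum n
  have h2 := hB n
  have h3 : κ * a ^ 2 / (4 * b) * ∑ i ∈ Finset.range n, (-(x i / μ i)) ^ 2 ≤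
      κ / (4 * b) * ∑ i ∈ Finset.range n, x i ^ 2 := by
    rw [Finset.mul_sum, Finset.mul_sum]
    refine Finset.sum_le_sum fun i _ => ?_
    have := hμ0 i
    have h4 : a ^ 2 ≤ μ i ^ 2 := by gcongr; exact (hμ i).1
    calc _ = κ / (4 * b) * (x i ^ 2 * (a ^ 2 / μ i ^ 2)) := by ring
      _ ≤ κ / (4 * b) * (x i ^ 2 * 1) := by
        gcongr
        exact (div_le_one (by positivity)).mpr h4
      _ = _ := by ring
  have h4 : κ / b * ∑ i ∈ Finset.range n, x i ^ 2 =
      κ / (2 * b) * ∑ i ∈ Finset.range n, x i ^ 2 +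
      2 * (κ / (4 * b) * ∑ i ∈ Finset.range n, x i ^ 2) := by
    ring
  change _ + κ / (2 * b) * ∑ i ∈ Finset.range n, x i ^ 2 ≤ _
  linarith

/-- The determinant is controlled by the trace, and traces of the two matrices compare term by term.
The initial matrices may differ, which lets the preliminary recursion be measured against the
information matrix of the accelerated one. -/
lemma exists_log_det_le (hd : 1 ≤ d) (hP0 : (P 0).PosDef)
    (hP : ∀ k, P (k + 1) = updateP (P k) (φ k) (μ k) (β k)) (ha : 0 < a) (hμ : ∀ k, a ≤ μ k)
    (hβ : ∀ k, 0 ≤ β k ∧ β k ≤ u) {P₀ : Mat d} (hP₀ : P₀.PosDef) :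
    ∃ A : ℝ, ∀ n, Real.log (P (n + 1))⁻¹.det ≤
      A + d * Real.log (lamMax (infoMatrix P₀ φ n)) := by
  have : Nonempty (Fin d) := ⟨⟨0, hd⟩⟩
  have hμ0 : ∀ k, 0 < μ k := fun k => ha.trans_le (hμ k)
  have hβ0 : ∀ k, 0 ≤ β k := fun k => (hβ k).1
  have hu : 0 ≤ u := (hβ0 0).trans (hβ 0).2
  have ht0 := hP0.inv.trace_pos
  have ht1 := hP₀.inv.trace_pos
  -- The first summand compares the initial matrices, the second bounds the ratios `β i / μ i`.
  set A := (P 0)⁻¹.trace / P₀⁻¹.trace + u / a with hA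
  have hA0 : 0 < A := by positivity
  have hd0 : (0 : ℝ) < d := by exact_mod_cast hd
  refine ⟨d * Real.log (A * d), fun n => ?_⟩
  have hpos := (posDef_of_recursion hP0 hP hμ0 hβ0 (n + 1)).inv
  have hlam := lamMax_pos hd (posDef_infoMatrix hP₀ φ n)
  have htr : (P (n + 1))⁻¹.trace ≤ A * (infoMatrix P₀ φ n).trace := by
    rw [inv_of_recursion hP0 hP hμ0 hβ0, trace_add_sum, infoMatrix_eq, trace_add_sum, mul_add]
    have hφ : ∀ i, 0 ≤ φ i ⬝ᵥ φ i := fun i => by rw [← norm_toLp_sq]; positivity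
    refine add_le_add ?_ ?_
    · calc (P 0)⁻¹.trace = (P 0)⁻¹.trace / P₀⁻¹.trace * P₀⁻¹.trace := by field_simp
        _ ≤ A * P₀⁻¹.trace := by gcongr; rw [hA]; exact le_add_of_nonneg_right (by positivity)
    · rw [Finset.mul_sum]
      refine Finset.sum_le_sum fun i _ => ?_
      rw [one_mul]
      refine mul_le_mul_of_nonneg_right ?_ (hφ i)
      calc β i / μ i ≤ u / a := by gcongr; exacts [(hβ i).2, hμ i]
        _ ≤ A := by rw [hA]; exact le_add_of_nonneg_left (by positivity)
  calc _ ≤ d * Real.log (P (n + 1))⁻¹.trace := log_det_le hd hpos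
    _ ≤ d * Real.log (A * d * lamMax (infoMatrix P₀ φ n)) := by
        have := hpos.trace_pos
        gcongr
        refine htr.trans ?_
        rw [mul_assoc]
        gcongr
        exact trace_le_lamMax (posDef_infoMatrix hP₀ φ n).1
    _ = _ := by rw [Real.log_mul (by positivity) hlam.ne', mul_add]

/-- The initial matrices agree and each rank-one coefficient `β i / μ i` is at least `l / b`. The
indices match because `infoMatrix` at `n` has `n + 1` rank-one terms, as does `P (n + 1)⁻¹`. -/
lemma min_mul_lamMin_le (hP0 : (P 0).PosDef)
    (hP : ∀ k, P (k + 1) = updateP (P k) (φ k) (μ k) (β k)) (ha : 0 < a)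
    (hμ : ∀ k, a ≤ μ k ∧ μ k ≤ b) (hl : 0 < l) (hβ : ∀ k, l ≤ β k) (n : ℕ) (z : Vec d) :
    min 1 (l / b) * (lamMin (infoMatrix (P 0) φ n) * (z ⬝ᵥ z)) ≤ wnormSq (P (n + 1))⁻¹ z := by
  have hμ0 : ∀ k, 0 < μ k := fun k => ha.trans_le (hμ k).1
  have hβ0 : ∀ k, 0 ≤ β k := fun k => hl.le.trans (hβ k)
  have hb : 0 < b := (hμ0 0).trans_le (hμ 0).2
  have h0 : 0 ≤ min 1 (l / b) := by positivity
  calc _ ≤ min 1 (l / b) * wnormSq (infoMatrix (P 0) φ n) z :=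
        mul_le_mul_of_nonneg_left (lamMin_mul_le (posDef_infoMatrix hP0 φ n).1 z) h0
    _ ≤ _ := by
        rw [inv_of_recursion hP0 hP hμ0 hβ0, infoMatrix_eq, wnormSq_add_sum, wnormSq_add_sum,
          mul_add, Finset.mul_sum]
        refine add_le_add ?_ (Finset.sum_le_sum fun i _ => ?_)
        · exact mul_le_of_le_one_left (wnormSq_nonneg hP0.inv.posSemidef z) (min_le_left _ _)
        · rw [one_mul]
          refine mul_le_mul_of_nonneg_right ((min_le_right _ _).trans ?_) (sq_nonneg _)
          have := hμ0 i
          have := hβ0 i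
          gcongr
          exacts [hβ i, (hμ i).2]

end Recursion

section Pathwise

variable {s : ℕ → Sample d} {σ₀ : State d} {θ : Vec d} {R l u a b : ℝ}

lemma run_mem (hc : IsCompact K) (hne : K.Nonempty) (h1 : σ₀.θbar ∈ K) (h2 : σ₀.θ ∈ K) (k : ℕ) :
    (run m K σ₀ s k).θbar ∈ K ∧ (run m K σ₀ s k).θ ∈ K := by
  cases k with
  | zero => exact ⟨h1, h2⟩
  | succ k => exact ⟨updateTheta_mem hc hne _ _ _ _ _ _, updateTheta_mem hc hne _ _ _ _ _ _⟩

/-- The weight `-φ_kᵀ (θ - η) / μ_k` of the noise in the Lyapunov inequality. -/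
def weight (θ η φ : Vec d) (μ : ℝ) : ℝ := -((φ ⬝ᵥ (θ - η)) / μ)

/-- A deterministic statement about one path: probability enters only through the two noise bounds.
The energy inequality is applied first to the preliminary recursion, then to the accelerated one
with the preliminary errors as input. -/
theorem exists_norm_sq_mul_lamMin_le (hd : 1 ≤ d) (hm : 1 ≤ m) (hK : Convex ℝ K) (hc : IsCompact K)
    (hθ : θ ∈ K) (hs : ∀ k, (s k).Regular m) (hl : 0 < l) (hb : ∀ k, (s k).Bounded m K R l u)
    (ha : 0 < a) (hμbar : ∀ k, a ≤ (s k).μbar ∧ (s k).μbar ≤ b)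
    (hμ : ∀ k, a ≤ (s k).μ ∧ (s k).μ ≤ b)
    (hθbar₀ : σ₀.θbar ∈ K) (hθ₀ : σ₀.θ ∈ K) (hPbar₀ : σ₀.Pbar.PosDef) (hP₀ : σ₀.P.PosDef)
    (hnoisebar : ∀ δ > 0, ∃ B : ℝ, ∀ n,
      ∑ i ∈ Finset.range n, weight θ (run m K σ₀ s i).θbar (s i).φ (s i).μbar *
        noise m (s i) ((s i).φ ⬝ᵥ θ) ((s i).φ ⬝ᵥ (run m K σ₀ s i).θbar) ≤
      δ * ∑ i ∈ Finset.range n, weight θ (run m K σ₀ s i).θbar (s i).φ (s i).μbar ^ 2 + B)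
    (hnoise : ∀ δ > 0, ∃ B : ℝ, ∀ n,
      ∑ i ∈ Finset.range n, weight θ (run m K σ₀ s i).θ (s i).φ (s i).μ *
        noise m (s i) ((s i).φ ⬝ᵥ θ) ((s i).φ ⬝ᵥ (run m K σ₀ s i).θ) ≤
      δ * ∑ i ∈ Finset.range n, weight θ (run m K σ₀ s i).θ (s i).φ (s i).μ ^ 2 + B) :
    ∃ C₀ C₁ : ℝ, ∀ n,
      lamMin (infoMatrix σ₀.P (fun i => (s i).φ) n) *
        ‖WithLp.toLp 2 (θ - (run m K σ₀ s (n + 1)).θ)‖ ^ 2 ≤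
      C₀ + C₁ * Real.log (lamMax (infoMatrix σ₀.P (fun i => (s i).φ) n)) := by
  have hne : K.Nonempty := ⟨θ, hθ⟩
  have hmem := run_mem (m := m) (s := s) hc hne hθbar₀ hθ₀
  set σ := run m K σ₀ s with hσ
  have hG : ∀ k, 0 ≤ (s k).G := fun k => (abs_nonneg _).trans ((hb k).pred θ hθ)
  have hz : ∀ k, |(s k).φ ⬝ᵥ θ| ≤ (s k).G := fun k => (hb k).pred θ hθ
  have hzbar : ∀ k, |(s k).φ ⬝ᵥ (σ k).θbar| ≤ (s k).G := fun k => (hb k).pred _ (hmem k).1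
  have hzhat : ∀ k, |(s k).φ ⬝ᵥ (σ k).θ| ≤ (s k).G := fun k => (hb k).pred _ (hmem k).2
  have hβbar := fun k => betaBar_mem_Icc (hs k) (hb k) hm (hG k)
  have hβ := fun k => beta_mem_Icc hm (hs k) (hb k) hl (hzhat k) (hzbar k)
  have hbpos : 0 < b := ha.trans_le ((hμ 0).1.trans (hμ 0).2)
  have hu : 0 < u := hl.trans_le ((hβbar 0).1.trans (hβbar 0).2)
  have hm0 : (0 : ℝ) < m := by exact_mod_cast hm
  -- No input error here: twice the drift outweighs the expansion `βbar x²`, leaving `-βbar x² ≤ -l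
  -- x²`.
  obtain ⟨D₀, D₁, hD₁, hD⟩ := exists_energy_le (P := fun k => (σ k).Pbar) (η := fun k => (σ k).θbar)
    (φ := fun k => (s k).φ) (μ := fun k => (s k).μbar) (β := fun k => betaBar m (s k))
    (v := fun k => innovation m (s k) ((s k).φ ⬝ᵥ (σ k).θbar))
    (ψ := fun k => drift m (s k) ((s k).φ ⬝ᵥ θ) ((s k).φ ⬝ᵥ (σ k).θbar))
    (w := fun k => noise m (s k) ((s k).φ ⬝ᵥ θ) ((s k).φ ⬝ᵥ (σ k).θbar))
    (e := fun _ => 0) (κ := l) hK hc hθ hPbar₀ (fun k => rfl) (fun k => rfl)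
    (fun k => innovation_eq_drift_add_noise hm (hs k) _ _)
    (fun k => abs_innovation_le hm (hs k) _) ha hμbar hl (fun k => (hβbar k).1) hl
    (fun k => le_rfl) (fun k => by
      have h1 := betaBar_mul_sq_le hm (hs k) (hzbar k) (hz k)
      have h2 := mul_le_mul_of_nonneg_right (hβbar k).1
        (sq_nonneg ((s k).φ ⬝ᵥ θ - (s k).φ ⬝ᵥ (σ k).θbar))
      simp only [dotProduct_sub]
      linarith) hnoisebar
  obtain ⟨Abar, hAbar⟩ := exists_log_det_le (P := fun k => (σ k).Pbar) (φ := fun k => (s k).φ)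
    (μ := fun k => (s k).μbar) (β := fun k => betaBar m (s k)) hd hPbar₀ (fun k => rfl) ha
    (fun k => (hμbar k).1) (fun k => ⟨hl.le.trans (hβbar k).1, (hβbar k).2⟩) hP₀
  -- The first term comes from `2βXY ≤ (β/2)X² + 2βY²` with `β ≤ m u`, the second from `-2Xr ≤
  -- (l/4)X² + (4/l)r²` with `|r| ≤ m u |Y|`. As `β ≥ l`, at least `(l/4)X²` of the dissipation
  -- remains.
  set E : ℝ := 2 * (m * u) + 4 * (m * u) ^ 2 / l with hE
  have hE0 : 0 ≤ E := by positivity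
  obtain ⟨B₀, B₁, hB₁, hB⟩ := exists_energy_le (P := fun k => (σ k).P) (η := fun k => (σ k).θ)
    (φ := fun k => (s k).φ) (μ := fun k => (s k).μ)
    (β := fun k => beta m (s k) ((s k).φ ⬝ᵥ (σ k).θ) ((s k).φ ⬝ᵥ (σ k).θbar))
    (v := fun k => innovation m (s k) ((s k).φ ⬝ᵥ (σ k).θ))
    (ψ := fun k => drift m (s k) ((s k).φ ⬝ᵥ θ) ((s k).φ ⬝ᵥ (σ k).θ))
    (w := fun k => noise m (s k) ((s k).φ ⬝ᵥ θ) ((s k).φ ⬝ᵥ (σ k).θ))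
    (e := fun k => E * ((s k).φ ⬝ᵥ (θ - (σ k).θbar)) ^ 2) (κ := l / 4) hK hc hθ hP₀
    (fun k => rfl) (fun k => rfl)
    (fun k => innovation_eq_drift_add_noise hm (hs k) _ _)
    (fun k => abs_innovation_le hm (hs k) _) ha hμ hl (fun k => (hβ k).1) (by positivity)
    (fun k => by positivity) (fun k => by
      have h1 := abs_drift_sub_le hm (hs k) (hb k) (x := (s k).φ ⬝ᵥ (σ k).θ) (hzbar k) (hz k)
      have h2 := hβ k
      set β := beta m (s k) ((s k).φ ⬝ᵥ (σ k).θ) ((s k).φ ⬝ᵥ (σ k).θbar)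
      set ψ := drift m (s k) ((s k).φ ⬝ᵥ θ) ((s k).φ ⬝ᵥ (σ k).θ)
      simp only [dotProduct_sub]
      set z := (s k).φ ⬝ᵥ θ
      set X := z - (s k).φ ⬝ᵥ (σ k).θ with hX
      set Y := z - (s k).φ ⬝ᵥ (σ k).θbar with hY
      have h3 : (s k).φ ⬝ᵥ (σ k).θbar - (s k).φ ⬝ᵥ (σ k).θ = X - Y := by rw [hX, hY]; ring
      rw [h3] at h1
      set r := ψ - β * (X - Y) with hr
      have h4 : ψ = β * (X - Y) + r := by rw [hr]; ring
      have h5 : -(2 * X * r) ≤ l / 4 * X ^ 2 + 4 * (m * u) ^ 2 / l * Y ^ 2 := by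
        have h6 : r ^ 2 ≤ (m * u) ^ 2 * Y ^ 2 := by
          have := pow_le_pow_left₀ (abs_nonneg r) h1 2
          rw [sq_abs] at this
          calc _ ≤ _ := this
            _ = (m * u) ^ 2 * |Y| ^ 2 := by ring
            _ = _ := by rw [sq_abs]
        have h7 : -(2 * X * r) ≤ l / 4 * X ^ 2 + 4 / l * r ^ 2 := by
          have h8 : l / 4 * X ^ 2 + 4 / l * r ^ 2 + 2 * X * r = l / 4 * (X + 4 / l * r) ^ 2 := by
            field_simp
            ring
          have : 0 ≤ l / 4 * (X + 4 / l * r) ^ 2 := by positivity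
          linarith
        calc _ ≤ _ := h7
          _ ≤ l / 4 * X ^ 2 + 4 / l * ((m * u) ^ 2 * Y ^ 2) := by gcongr
          _ = _ := by ring
      have h9 : 2 * β * X * Y ≤ β / 2 * X ^ 2 + 2 * β * Y ^ 2 := by
        nlinarith [mul_nonneg (hl.le.trans h2.1) (sq_nonneg (X - 2 * Y))]
      have h10 : β * Y ^ 2 ≤ m * u * Y ^ 2 := by gcongr; exact h2.2
      have h11 : l * X ^ 2 ≤ β * X ^ 2 := by gcongr; exact h2.1
      have h12 : β * X ^ 2 - 2 * X * ψ = -(β * X ^ 2) + 2 * β * X * Y + -(2 * X * r) := by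
        rw [h4]; ring
      rw [h12, hE]
      nlinarith) hnoise
  obtain ⟨A, hA⟩ := exists_log_det_le (P := fun k => (σ k).P) (φ := fun k => (s k).φ)
    (μ := fun k => (s k).μ)
    (β := fun k => beta m (s k) ((s k).φ ⬝ᵥ (σ k).θ) ((s k).φ ⬝ᵥ (σ k).θbar)) hd hP₀
    (fun k => rfl) ha (fun k => (hμ k).1) (fun k => ⟨hl.le.trans (hβ k).1, (hβ k).2⟩) hP₀
  have hmin : 0 < min 1 (l / b) := by positivity
  set ρ := min 1 (l / b)
  refine ⟨(B₀ + 1 / a * (E * (2 * b / l * (D₀ + D₁ * Abar))) + B₁ * A) / ρ,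
    (1 / a * (E * (2 * b / l * (D₁ * d))) + B₁ * d) / ρ, fun n => ?_⟩
  set L := Real.log (lamMax (infoMatrix σ₀.P (fun i => (s i).φ) n))
  have hbar : ∑ i ∈ Finset.range (n + 1), ((s i).φ ⬝ᵥ (θ - (σ i).θbar)) ^ 2 ≤
      2 * b / l * (D₀ + D₁ * Abar + D₁ * d * L) := by
    have h1 := hD (n + 1)
    have h2 : 0 ≤ wnormSq ((σ (n + 1)).Pbar)⁻¹ (θ - (σ (n + 1)).θbar) :=
      wnormSq_nonneg (posDef_of_recursion (P := fun k => (σ k).Pbar) (φ := fun k => (s k).φ)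
        (μ := fun k => (s k).μbar) (β := fun k => betaBar m (s k)) hPbar₀ (fun k => rfl)
        (fun k => (hs k).μbar_pos) (fun k => betaBar_nonneg (hs k)) (n + 1)).inv.posSemidef _
    have h3 := mul_le_mul_of_nonneg_left (hAbar n) hD₁
    simp only [Finset.sum_const_zero, mul_zero, add_zero] at h1
    have h4 : l / (2 * b) * ∑ i ∈ Finset.range (n + 1), ((s i).φ ⬝ᵥ (θ - (σ i).θbar)) ^ 2 ≤
        D₀ + D₁ * Abar + D₁ * d * L := by linarith
    calc _ = 2 * b / l *
          (l / (2 * b) * ∑ i ∈ Finset.range (n + 1), ((s i).φ ⬝ᵥ (θ - (σ i).θbar)) ^ 2) := by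
          field_simp
      _ ≤ _ := by gcongr
  have hlow := min_mul_lamMin_le (P := fun k => (σ k).P) (φ := fun k => (s k).φ)
    (μ := fun k => (s k).μ)
    (β := fun k => beta m (s k) ((s k).φ ⬝ᵥ (σ k).θ) ((s k).φ ⬝ᵥ (σ k).θbar)) hP₀
    (fun k => rfl) ha hμ hl (fun k => (hβ k).1) n (θ - (σ (n + 1)).θ)
  have h1 := hB (n + 1)
  rw [← Finset.mul_sum] at h1
  have h2 : 0 ≤ l / 4 / (2 * b) *
      ∑ i ∈ Finset.range (n + 1), ((s i).φ ⬝ᵥ (θ - (σ i).θ)) ^ 2 :=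
    mul_nonneg (by positivity) (Finset.sum_nonneg fun i _ => sq_nonneg _)
  have h3 := mul_le_mul_of_nonneg_left (hA n) hB₁
  have h4 : 1 / a * (E * ∑ i ∈ Finset.range (n + 1), ((s i).φ ⬝ᵥ (θ - (σ i).θbar)) ^ 2) ≤
      1 / a * (E * (2 * b / l * (D₀ + D₁ * Abar + D₁ * d * L))) := by gcongr
  rw [norm_toLp_sq, ← mul_le_mul_iff_right₀ hmin]
  refine hlow.trans ?_
  calc _ ≤ B₀ + 1 / a * (E * (2 * b / l * (D₀ + D₁ * Abar + D₁ * d * L))) +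
        B₁ * (A + d * L) := by linarith
    _ = _ := by
        field_simp
        ring

/-- Monotonicity keeps `log lmax` above a fixed positive number from some index on, so the additive
constant `C₀` is absorbed into a multiple of the logarithm. -/
lemma isBigO_and_tendsto {est : ℕ → Vec d} {lmin lmax : ℕ → ℝ} {C₀ C₁ : ℝ}
    (hmin : ∀ k, 0 < lmin k) (hmono : Monotone lmax)
    (h : ∀ n, lmin n * ‖WithLp.toLp 2 (θ - est (n + 1))‖ ^ 2 ≤ C₀ + C₁ * Real.log (lmax n))
    (hex : ∃ k, 1 < lmax k) :
    ((fun k => ‖WithLp.toLp 2 (θ - est (k + 1))‖ ^ 2) =O[atTop]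
        (fun k => Real.log (lmax k) / lmin k)) ∧
      (Tendsto (fun k => Real.log (lmax k) / lmin k) atTop (𝓝 0) →
        Tendsto est atTop (𝓝 θ)) := by
  obtain ⟨k₀, hk₀⟩ := hex
  have hρ := Real.log_pos hk₀
  set ρ := Real.log (lmax k₀)
  have hO : (fun k => ‖WithLp.toLp 2 (θ - est (k + 1))‖ ^ 2) =O[atTop]
      (fun k => Real.log (lmax k) / lmin k) := by
    refine IsBigO.of_bound (|C₀| / ρ + C₁) ?_
    filter_upwards [eventually_ge_atTop k₀] with k hk
    have h1 : ρ ≤ Real.log (lmax k) := Real.log_le_log (by linarith) (hmono hk)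
    have h2 := hmin k
    have h3 : 0 < Real.log (lmax k) := hρ.trans_le h1
    rw [Real.norm_of_nonneg (by positivity), Real.norm_of_nonneg (by positivity),
      ← mul_div_assoc, le_div_iff₀ h2, mul_comm]
    refine (h k).trans ?_
    have h4 : C₀ ≤ |C₀| / ρ * Real.log (lmax k) := by
      calc C₀ ≤ |C₀| := le_abs_self _
        _ = |C₀| / ρ * ρ := by field_simp
        _ ≤ _ := by gcongr
    linarith
  refine ⟨hO, fun ht => ?_⟩
  have h1 := hO.trans_tendsto ht
  have h2 : Tendsto (fun k => ‖WithLp.toLp 2 (θ - est (k + 1))‖) atTop (𝓝 0) := by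
    have := h1.sqrt
    simpa [Real.sqrt_sq (norm_nonneg _)] using this
  have h3 : Tendsto (fun k => WithLp.toLp 2 (θ - est (k + 1))) atTop (𝓝 0) :=
    tendsto_zero_iff_norm_tendsto_zero.mpr h2
  have h4 : Tendsto (fun k => θ - est (k + 1)) atTop (𝓝 0) :=
    ((PiLp.continuous_ofLp 2 (fun _ : Fin d => ℝ)).tendsto 0).comp h3
  rw [← tendsto_add_atTop_iff_nat 1]
  simpa using (tendsto_const_nhds (x := θ)).sub h4

end Pathwise

end ADA
end

/-! ### Stochastic verification of the noise bounds and conclusion. -/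

noncomputable section

namespace ADA

variable {d m : ℕ} {Ω : Type*} {K : Set (Vec d)}

lemma MeasurableData.mono {𝒢 ℋ : MeasurableSpace Ω} (h : 𝒢 ≤ ℋ) {s : Ω → Sample d}
    (hs : MeasurableData 𝒢 m s) : MeasurableData ℋ m s :=
  { regular := hs.regular
    φ := hs.φ.mono h le_rfl
    c := fun i hi => (hs.c i hi).mono h le_rfl
    F := fun x => (hs.F x).mono h le_rfl
    G := hs.G.mono h le_rfl
    μbar := hs.μbar.mono h le_rfl
    μ := hs.μ.mono h le_rfl }

lemma MeasurableState.mono {𝒢 ℋ : MeasurableSpace Ω} (h : 𝒢 ≤ ℋ) {σ : Ω → State d}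
    (hσ : MeasurableState 𝒢 σ) : MeasurableState ℋ σ :=
  { θbar := hσ.θbar.mono h le_rfl
    Pbar := fun i j => (hσ.Pbar i j).mono h le_rfl
    θ := hσ.θ.mono h le_rfl
    P := fun i j => (hσ.P i j).mono h le_rfl
    posDef_Pbar := hσ.posDef_Pbar
    posDef_P := hσ.posDef_P }

lemma measurableState_run {mΩ : MeasurableSpace Ω} {ℱ : Filtration ℕ mΩ} (hK : Convex ℝ K)
    (hc : IsCompact K) (hne : K.Nonempty) (hm : 1 ≤ m) {σ₀ : State d} (hPbar₀ : σ₀.Pbar.PosDef)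
    (hP₀ : σ₀.P.PosDef) {s : ℕ → Ω → Sample d} (hs : ∀ k, MeasurableData (ℱ k) m (s k))
    (hy : ∀ k, Measurable[ℱ (k + 1)] fun ω => (s k ω).y) (k : ℕ) :
    MeasurableState (ℱ k) fun ω => run m K σ₀ (fun j => s j ω) k := by
  induction k with
  | zero =>
    exact
      { θbar := measurable_const (a := σ₀.θbar)
        Pbar := fun i j => measurable_const (a := σ₀.Pbar i j)
        θ := measurable_const (a := σ₀.θ)
        P := fun i j => measurable_const (a := σ₀.P i j)
        posDef_Pbar := fun _ => hPbar₀
        posDef_P := fun _ => hP₀ }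
  | succ k ih =>
    have hle : ℱ k ≤ ℱ (k + 1) := ℱ.mono (Nat.le_succ k)
    exact MeasurableState.step hK hc hne hm (ih.mono hle) ((hs k).mono hle) (hy k)

/-- The noise part of the innovation is a sequence of martingale differences. -/
lemma integral_mul_noise_eq_zero {𝒢 : MeasurableSpace Ω} [mΩ : MeasurableSpace Ω] {Pr : Measure Ω}
    [IsProbabilityMeasure Pr] (h𝒢 : 𝒢 ≤ mΩ) {s : Ω → Sample d} (hs : MeasurableData 𝒢 m s)
    {X : Ω → ℝ} (hX : Measurable X)
    (hlaw : IsCondLaw Pr 𝒢 X (fun ω => (s ω).F) (fun ω => (s ω).f)) {x z : Ω → ℝ}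
    (hx : Measurable[𝒢] x) (hz : Measurable[𝒢] z)
    (hy : ∀ ω, (s ω).y = quantizer m (s ω).c (z ω + X ω)) {Z : Ω → ℝ} (hZ : Measurable[𝒢] Z)
    {B : ℝ} (hB : ∀ ω, |Z ω| ≤ B) :
    ∫ ω, Z ω * noise m (s ω) (z ω) (x ω) ∂Pr = 0 := by
  have hym : Measurable fun ω => (s ω).y := by
    simp only [hy]
    exact (hs.mono h𝒢).measurable_quantizer ((hz.mono h𝒢 le_rfl).add hX)
  have h1 : ∀ ω, Z ω * noise m (s ω) (z ω) (x ω) = ∑ i ∈ Finset.Icc 1 m,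
      (Z ω * adjacent m (s ω).c (x ω) i) *
        ((s ω).F ((s ω).c i - z ω) - if X ω ≤ (s ω).c i - z ω then 1 else 0) := by
    intro ω
    rw [noise, Finset.mul_sum]
    refine Finset.sum_congr rfl fun i hi => ?_
    rw [Finset.mem_Icc] at hi
    -- The observation indicator becomes the event that the noise lies below a threshold known
    -- before the observation, so each term has mean zero by the conditional law.
    have h2 : (s ω).y ≤ i ↔ X ω ≤ (s ω).c i - z ω := by
      rw [hy, quantizer_le_iff (hs.regular ω).ordered hi.1 hi.2, le_sub_iff_add_le']
    simp only [h2, mul_assoc]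
  have hbound : ∀ i ω, |Z ω * adjacent m (s ω).c (x ω) i| ≤ B := by
    intro i ω
    rw [abs_mul, abs_of_nonneg (adjacent_nonneg _ _)]
    exact (mul_le_of_le_one_right (abs_nonneg _) (adjacent_le_one _ _)).trans (hB ω)
  have hT : ∀ i ∈ Finset.Icc 1 m, Measurable[𝒢] fun ω => (s ω).c i - z ω :=
    fun i hi => Measurable.sub (hs.c i hi) hz
  have hA : ∀ i, Measurable[𝒢] fun ω => Z ω * adjacent m (s ω).c (x ω) i :=
    fun i => Measurable.mul hZ (hs.measurable_adjacent hx i)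
  simp only [h1]
  rw [integral_finsetSum]
  · refine Finset.sum_eq_zero fun i hi => ?_
    exact hlaw.integral_mul_eq_zero h𝒢 hX (hT i hi) (hA i) (hbound i)
  · intro i hi
    have hTm : Measurable fun ω => (s ω).c i - z ω := (hT i hi).mono h𝒢 le_rfl
    have hFm : Measurable fun ω => (s ω).F ((s ω).c i - z ω) :=
      (hs.mono h𝒢).measurable_cdf hTm
    refine Integrable.of_bound (((hA i).mono h𝒢 le_rfl).mul (hFm.sub (Measurable.ite
      (measurableSet_le hX hTm) measurable_const measurable_const))).aestronglyMeasurable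
      (B * 1) (ae_of_all _ fun ω => ?_)
    have hB0 : 0 ≤ B := (abs_nonneg _).trans (hB ω)
    have h2 := (hs.regular ω).law.cdf_nonneg ((s ω).c i - z ω)
    have h3 := (hs.regular ω).law.cdf_le_one ((s ω).c i - z ω)
    rw [Real.norm_eq_abs, abs_mul]
    gcongr
    · exact hbound i ω
    · rw [abs_le]
      split_ifs <;> constructor <;> linarith

/-- The weighted noise sums are almost surely negligible against the sums of squared weights. -/
lemma ae_noise_bound [mΩ : MeasurableSpace Ω] {Pr : Measure Ω} [IsProbabilityMeasure Pr]
    {ℱ : Filtration ℕ mΩ} (hm : 1 ≤ m) {s : ℕ → Ω → Sample d}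
    (hs : ∀ k, MeasurableData (ℱ k) m (s k))
    (hym : ∀ k, Measurable[ℱ (k + 1)] fun ω => (s k ω).y)
    {X : ℕ → Ω → ℝ} (hX : ∀ k, Measurable (X k))
    (hlaw : ∀ k, IsCondLaw Pr (ℱ k) (X k) (fun ω => (s k ω).F) (fun ω => (s k ω).f))
    {θ : Vec d} (hy : ∀ k ω, (s k ω).y = quantizer m (s k ω).c ((s k ω).φ ⬝ᵥ θ + X k ω))
    {η : ℕ → Ω → Vec d} (hη : ∀ k, Measurable[ℱ k] (η k))
    {μ : ℕ → Ω → ℝ} (hμ : ∀ k, Measurable[ℱ k] (μ k)) :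
    ∀ᵐ ω ∂Pr, ∀ δ > 0, ∃ B : ℝ, ∀ n,
      ∑ i ∈ Finset.range n, weight θ (η i ω) (s i ω).φ (μ i ω) *
        noise m (s i ω) ((s i ω).φ ⬝ᵥ θ) ((s i ω).φ ⬝ᵥ η i ω) ≤
      δ * ∑ i ∈ Finset.range n, weight θ (η i ω) (s i ω).φ (μ i ω) ^ 2 + B := by
  have hz : ∀ k, Measurable[ℱ k] fun ω => (s k ω).φ ⬝ᵥ θ := fun k =>
    measurable_dotProduct (hs k).φ measurable_const
  have hx : ∀ k, Measurable[ℱ k] fun ω => (s k ω).φ ⬝ᵥ η k ω := fun k =>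
    measurable_dotProduct (hs k).φ (hη k)
  refine ae_forall_exists_sum_mul_le ℱ (C := m)
    (w := fun k ω => noise m (s k ω) ((s k ω).φ ⬝ᵥ θ) ((s k ω).φ ⬝ᵥ η k ω))
    (g := fun k ω => weight θ (η k ω) (s k ω).φ (μ k ω))
    (by exact_mod_cast hm) (fun k ω => abs_noise_le ((hs k).regular ω) _ _) (fun k => ?_)
    (fun k => ?_) fun k Z hZ ⟨B, hB⟩ => ?_
  · have hle : ℱ k ≤ ℱ (k + 1) := ℱ.mono (Nat.le_succ k)
    exact ((hs k).mono hle).measurable_noise (hym k) ((hx k).mono hle le_rfl)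
      ((hz k).mono hle le_rfl)
  · refine Measurable.neg (Measurable.div ?_ (hμ k))
    simp only [dotProduct_sub]
    exact Measurable.sub (hz k) (hx k)
  · exact integral_mul_noise_eq_zero (ℱ.le k) (hs k) (hX k) (hlaw k) (hx k) (hz k) (hy k) hZ hB

end ADA
end

theorem theorem1 {Ω : Type*} [mΩ : MeasurableSpace Ω] (Pr : Measure Ω) [IsProbabilityMeasure Pr]
    (ℱ : Filtration ℕ mΩ) (d m : ℕ) (hd : 1 ≤ d) (hm : 1 ≤ m)
    -- thresholds `c k i = c_{ik}`, `1 ≤ i ≤ m`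
    (c : ℕ → ℕ → Ω → ℝ) (Λc : ℝ)
    (hc_adapted : ∀ k i, 1 ≤ i → i ≤ m → Measurable[ℱ k] (c k i))
    (hc_mono : ∀ k ω i j, 1 ≤ i → i ≤ j → j ≤ m → c k i ω ≤ c k j ω)
    (hΛc : 0 < Λc)
    (hc_bdd : ∀ᵐ ω ∂Pr, ∀ k, max (c k m ω) (-(c k 1 ω)) ≤ Λc)
    -- regressors, parameter and the set `K`
    (φ : ℕ → Ω → ADA.Vec d)
    (hφ_adapted : ∀ k, Measurable[ℱ k] (φ k))
    (hφ_bdd : ∀ᵐ ω ∂Pr, BddAbove (Set.range fun k => ‖WithLp.toLp 2 (φ k ω)‖))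
    (K : Set (ADA.Vec d)) (hK_convex : Convex ℝ K) (hK_compact : IsCompact K)
    (θ : ADA.Vec d) (hθ : θ ∈ interior K)
    -- the bounds `G_k` and the constant `G`
    (Gs : ℕ → Ω → ℝ) (G : ℝ)
    (hGs_adapted : ∀ k, Measurable[ℱ k] (Gs k))
    (hGs : ∀ᵐ ω ∂Pr, ∀ k, ∀ x ∈ K, |φ k ω ⬝ᵥ x| ≤ Gs k ω)
    (hG : ∀ᵐ ω ∂Pr, ∀ k, Gs k ω ≤ G)
    -- noise, with conditional distribution function `F (k + 1)` and density `f (k + 1)` given `ℱ k`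
    (ε : ℕ → Ω → ℝ) (hε : ∀ k, Measurable (ε (k + 1)))
    (F f : ℕ → Ω → ℝ → ℝ)
    (hF : ∀ k, ADA.IsCondLaw Pr (ℱ k) (ε (k + 1)) (F (k + 1)) (f (k + 1)))
    (hF_median : ∀ᵐ ω ∂Pr, ∀ k, F (k + 1) ω 0 = 1 / 2)
    (hf_bdd : ∀ᵐ ω ∂Pr, ∃ l u : ℝ, 0 < l ∧
      ∀ k x, |x| ≤ G + Λc → l ≤ f (k + 1) ω x ∧ f (k + 1) ω x ≤ u)
    -- quantized observations
    (y : ℕ → Ω → ℕ)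
    (hy : ∀ k ω, y (k + 1) ω =
      ADA.quantizer m (fun i => c k i ω) (φ k ω ⬝ᵥ θ + ε (k + 1) ω))
    (hy_adapted : ∀ k, Measurable[ℱ (k + 1)] (y (k + 1)))
    -- parameters and initial values of the algorithm
    (μbar μ : ℕ → Ω → ℝ)
    (hμbar_adapted : ∀ k, Measurable[ℱ k] (μbar k)) (hμ_adapted : ∀ k, Measurable[ℱ k] (μ k))
    (hμbar : ∀ ω, ∃ l u : ℝ, 0 < l ∧ ∀ k, l ≤ μbar k ω ∧ μbar k ω ≤ u)
    (hμ : ∀ ω, ∃ l u : ℝ, 0 < l ∧ ∀ k, l ≤ μ k ω ∧ μ k ω ≤ u)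
    (θbar₀ θ₀ : ADA.Vec d) (hθbar₀ : θbar₀ ∈ K) (hθ₀ : θ₀ ∈ K)
    (Pbar₀ P₀ : ADA.Mat d) (hPbar₀ : Pbar₀.PosDef) (hP₀ : P₀.PosDef)
    -- the accelerated estimates `θ_k` and the extreme eigenvalues
    (est : ℕ → Ω → ADA.Vec d)
    (hest : ∀ k ω, est k ω =
      (ADA.run m K ⟨θbar₀, Pbar₀, θ₀, P₀⟩
        (fun j => ⟨φ j ω, fun i => c j i ω, F (j + 1) ω, f (j + 1) ω, Gs j ω, μbar j ω, μ j ω,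
          y (j + 1) ω⟩) k).θ)
    (lmin lmax : ℕ → Ω → ℝ)
    (hlmin : ∀ k ω, lmin k ω = ADA.lamMin (ADA.infoMatrix P₀ (fun i => φ i ω) k))
    (hlmax : ∀ k ω, lmax k ω = ADA.lamMax (ADA.infoMatrix P₀ (fun i => φ i ω) k)) :
    ∀ᵐ ω ∂Pr, (∃ k, 1 < lmax k ω) →
      ((fun k => ‖WithLp.toLp 2 (θ - est (k + 1) ω)‖ ^ 2) =O[atTop]
        (fun k => Real.log (lmax k ω) / lmin k ω)) ∧
      (Tendsto (fun k => Real.log (lmax k ω) / lmin k ω) atTop (𝓝 0) →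
        Tendsto (fun k => est k ω) atTop (𝓝 θ)) := by
  have hθK : θ ∈ K := interior_subset hθ
  have hne : K.Nonempty := ⟨θ, hθK⟩
  set s : ℕ → Ω → ADA.Sample d := fun j ω => ⟨φ j ω, fun i => c j i ω, F (j + 1) ω, f (j + 1) ω,
    Gs j ω, μbar j ω, μ j ω, y (j + 1) ω⟩ with hs_def
  have hreg : ∀ k ω, (s k ω).Regular m := by
    intro k ω
    obtain ⟨l, u, hl, hlu⟩ := hμbar ω
    obtain ⟨l', u', hl', hlu'⟩ := hμ ω
    exact
      { ordered := hc_mono k ω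
        law := (hF k).isLaw ω
        one_le_y := by
          change 1 ≤ y (k + 1) ω
          rw [hy]
          exact ADA.one_le_quantizer _
        y_le := by
          change y (k + 1) ω ≤ m + 1
          rw [hy]
          exact ADA.quantizer_le _
        μbar_pos := hl.trans_le (hlu k).1
        μ_pos := hl'.trans_le (hlu' k).1 }
  have hdata : ∀ k, ADA.MeasurableData (ℱ k) m (s k) := fun k =>
    { regular := hreg k
      φ := hφ_adapted k
      c := fun i hi => hc_adapted k i (Finset.mem_Icc.mp hi).1 (Finset.mem_Icc.mp hi).2
      F := (hF k).measurable_cdf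
      G := hGs_adapted k
      μbar := hμbar_adapted k
      μ := hμ_adapted k }
  have hstate := fun k => ADA.measurableState_run (σ₀ := ⟨θbar₀, Pbar₀, θ₀, P₀⟩) hK_convex
    hK_compact hne hm hPbar₀ hP₀ hdata hy_adapted k
  have hnoisebar := ADA.ae_noise_bound hm hdata hy_adapted hε hF (θ := θ) hy
    (fun k => (hstate k).θbar) hμbar_adapted
  have hnoise := ADA.ae_noise_bound hm hdata hy_adapted hε hF (θ := θ) hy
    (fun k => (hstate k).θ) hμ_adapted
  filter_upwards [hc_bdd, hGs, hG, hf_bdd, hnoisebar, hnoise] with ω h1 h2 h3 h4 h5 h6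
  obtain ⟨l, u, hl, hlu⟩ := h4
  obtain ⟨a, b, ha, hab⟩ := hμbar ω
  obtain ⟨a', b', ha', hab'⟩ := hμ ω
  have hbounded : ∀ k, (s k ω).Bounded m K (G + Λc) l u := fun k =>
    { pred := h2 k
      upper := add_le_add (h3 k) ((le_max_left _ _).trans (h1 k))
      lower := by
        have := (le_max_right _ _).trans (h1 k)
        have := h3 k
        change Gs k ω - c k 1 ω ≤ _
        linarith
      density := hlu k }
  -- Minimum and maximum provide common bounds for the step parameters of both recursions at this
  -- sample point.
  obtain ⟨C₀, C₁, hC⟩ := ADA.exists_norm_sq_mul_lamMin_le (s := fun k => s k ω)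
    (σ₀ := ⟨θbar₀, Pbar₀, θ₀, P₀⟩) (a := min a a') (b := max b b') hd hm hK_convex hK_compact hθK
    (fun k => hreg k ω) hl hbounded (lt_min ha ha')
    (fun k => ⟨(min_le_left _ _).trans (hab k).1, (hab k).2.trans (le_max_left _ _)⟩)
    (fun k => ⟨(min_le_right _ _).trans (hab' k).1, (hab' k).2.trans (le_max_right _ _)⟩)
    hθbar₀ hθ₀ hPbar₀ hP₀ h5 h6
  refine ADA.isBigO_and_tendsto (C₀ := C₀) (C₁ := C₁) (est := fun k => est k ω)
    (lmin := fun k => lmin k ω) (lmax := fun k => lmax k ω) (fun k => ?_) ?_ fun n => ?_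
  · simp only [hlmin]
    exact ADA.lamMin_pos hd (ADA.posDef_infoMatrix hP₀ _ k)
  · simp only [hlmax]
    exact ADA.lamMax_infoMatrix_mono hd hP₀ _
  · simp only [hlmin, hlmax, hest]
    exact hC n
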